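/- Let $\mathfrak g$ be the Lie algebra of a compact simple gauge group, with a basis $(e_{\mathsf a})$, $[e_{\mathsf a},e_{\mathsf b}]=f^{\mathsf{abc}}e_{\mathsf c}$, orthogonal for the Killing form with $\kappa(e_{\mathsf a},e_{\mathsf b})=-C\,\delta_{\mathsf{ab}}$, $C>0$ (equivalently $f^{\mathsf{acd}}f^{\mathsf{bcd}}=C\delta^{\mathsf{ab}}$ with $f$ totally antisymmetric). Let $\eta=\mathrm{diag}(1,-1,\dots,-1)$ be the Minkowski metric on $\mathbb R^d$, let $A_\mu^{\mathsf a}$ (the background gauge potential) and $a_\mu^{\mathsf a}$ (the perturbation) be smooth functions on $\mathbb R^d$, real- or complex-valued; $A$ may be any background, in particular any solution of the Yang–Mills equations. Write $$D_\mu u^{\mathsf a}=\partial_\mu u^{\mathsf a}+f^{\mathsf{abc}}A_\mu^{\mathsf b}u^{\mathsf c},\qquad F^{\mathsf a}_{\mu\nu}=\partial_\mu A^{\mathsf a}_\nu-\partial_\nu A^{\mathsf a}_\mu+f^{\mathsf{abc}}A^{\mathsf b}_\mu A^{\mathsf c}_\nu .$$ The heterotic ambitwistor string on this background is the free chiral worldsheet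 CFT of the bosonic fields $X^\mu,\Pi_\mu$, the fermions $\psi^\mu$, a current algebra $j^{\mathsf a}$ of $\mathfrak g$ at level $0$, the fermionic ghosts $(c,b)$, $(\bar c,\bar b)$ and the bosonic ghosts $(\gamma,\beta)$, with OPEs $$X^\mu(z)\Pi_\nu(w)\sim\frac{\delta^\mu_\nu}{z-w},\quad \psi^\mu(z)\psi^\nu(w)\sim\frac{\eta^{\mu\nu}}{z-w},\quad j^{\mathsf a}(z)j^{\mathsf b}(w)\sim\frac{f^{\mathsf{abc}}j^{\mathsf c}(w)}{z-w},$$ $$c(z)b(w)\sim\bar c(z)\bar b(w)\sim\gamma(z)\beta(w)\sim\frac1{z-w}.$$ Its currents, normal ordered by point splitting, are $\mathsf G=\psi^\mu(\Pi_\mu-A^{\mathsf a}_\mu j^{\mathsf a})$ and $$\mathsf H=\Pi^2-2\Pi^\mu A^{\mathsf a}_\mu j^{\mathsf a}+A^{\mathsf a}_\mu A^{\mu\mathsf b}j^{\mathsf a}j^{\mathsf b}+\psi^\mu\psi^\nu F^{\mathsf a}_{\mu\nu}j^{\mathsf a}-\partial(\partial_\mu A^{\mu\mathsf a}j^{\mathsf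 a})+f^{\mathsf{abc}}j^{\mathsf c}A^{\mu\mathsf b}\partial A^{\mathsf a}_\mu ,$$ and the BRST operator is $$Q=\oint c\,T+bc\,\partial c+\gamma\,\mathsf G+\bar c\,\mathsf H-\tfrac12\,\bar b\,\gamma^2 ,$$ where $T=-\Pi_\mu\partial X^\mu-\tfrac12\psi_\mu\partial\psi^\mu-\tfrac1C j^{\mathsf a}j^{\mathsf a}+\bar c\,\partial\bar b-2\bar b\,\partial\bar c-\tfrac32\beta\,\partial\gamma-\tfrac12\gamma\,\partial\beta$ is the stress tensor of all fields except $(b,c)$. These act on the Neveu–Schwarz states of picture number $-1$: the Fock space over the vacuum $\delta(\gamma)$, with smooth functions of $X$ as wave functions, tensored with the level-$0$ vacuum module of the current algebra. For the fixed gluon vertex operator $V=c\,\bar c\,\delta(\gamma)\,\psi^\mu a^{\mathsf a}_\mu j^{\mathsf a}$ one has $$QV=c\,\bar c\,\delta(\gamma)\,j^{\mathsf a}\Big[\partial\bar c\,\psi^\nu\big(D^\mu D_\mu a^{\mathsf a}_\nu+2f^{\mathsf{abc}}a^{\mathsf b\mu}F^{\mathsf c}_{\mu\nu}\big)-\partial\gamma\,D^\mu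 a^{\mathsf a}_\mu\Big].$$ Consequently $QV=0$ if and only if $a$ satisfies both the Lorenz gauge condition $D^\mu a^{\mathsf a}_\mu=0$ and the linearised Yang–Mills equation $D^\mu D_\mu a^{\mathsf a}_\nu+2f^{\mathsf{abc}}a^{\mathsf b\mu}F^{\mathsf c}_{\mu\nu}=0$, for all $\mathsf a$ and $\nu$. -/

import Mathlib

open scoped TensorProduct ContDiff

noncomputable section

namespace Ambitwistor

/-! ### Minkowski space and smooth functions on it -/

/-- The diagonal entries of the Minkowski metric `diag(1, -1, …, -1)` on `ℝ^d`.  The metric is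
diagonal and equal to its own inverse, so an index is raised or lowered by multiplication by
`eta μ`. -/
def eta {d : ℕ} (μ : Fin d) : ℂ := if (μ : ℕ) = 0 then 1 else -1

/-- Smooth complex-valued functions on `ℝ^d`. -/
def smoothFn (d : ℕ) : Subalgebra ℂ ((Fin d → ℝ) → ℂ) where
  carrier := {f | ContDiff ℝ ∞ f}
  mul_mem' {f g} (hf : ContDiff ℝ ∞ f) (hg : ContDiff ℝ ∞ g) :=
    show ContDiff ℝ ∞ (f * g) from hf.mul hg
  add_mem' {f g} (hf : ContDiff ℝ ∞ f) (hg : ContDiff ℝ ∞ g) :=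
    show ContDiff ℝ ∞ (f + g) from hf.add hg
  algebraMap_mem' c := show ContDiff ℝ ∞ (fun _ : Fin d → ℝ => c) from contDiff_const

abbrev SmoothFn (d : ℕ) : Type := smoothFn d

theorem SmoothFn.contDiff {d : ℕ} (f : SmoothFn d) : ContDiff ℝ ∞ f.1 := f.2

theorem SmoothFn.differentiable {d : ℕ} (f : SmoothFn d) : Differentiable ℝ f.1 :=
  f.contDiff.differentiable (by simp)

/-- The coordinate function `x^μ`. -/
def coordFn {d : ℕ} (μ : Fin d) : SmoothFn d :=
  ⟨fun x => (x μ : ℂ),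
    show ContDiff ℝ ∞ (fun x : Fin d → ℝ => (x μ : ℂ)) from
      Complex.ofRealCLM.contDiff.comp (contDiff_apply ℝ ℝ μ)⟩

/-- The partial derivative `∂_μ`. -/
def pd {d : ℕ} (μ : Fin d) : SmoothFn d →ₗ[ℂ] SmoothFn d where
  toFun f := ⟨fun x => fderiv ℝ f.1 x (Pi.single μ 1),
    show ContDiff ℝ ∞ (fun x => fderiv ℝ f.1 x (Pi.single μ 1)) from
      (f.contDiff.fderiv_right (m := ∞) (by simp)).clm_apply contDiff_const⟩
  map_add' f g := by
    apply Subtype.ext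
    funext x
    change fderiv ℝ (f.1 + g.1) x (Pi.single μ 1) = _
    rw [fderiv_add (f.differentiable x) (g.differentiable x)]
    rfl
  map_smul' c f := by
    apply Subtype.ext
    funext x
    change fderiv ℝ (c • f.1) x (Pi.single μ 1) = _
    rw [fderiv_const_smul (f.differentiable x)]
    rfl

/-! ### Yang–Mills theory in components -/

section YangMills

variable {𝔤 ι : Type*} [LieRing 𝔤] [LieAlgebra ℝ 𝔤] [Fintype ι]

/-- The structure constants `f^{abc}`, defined by `[e_a, e_b] = ∑_c f^{abc} e_c`. -/
def structConst (e : Module.Basis ι ℝ 𝔤) (a b c : ι) : ℂ := ((e.repr ⁅e a, e b⁆ c : ℝ) : ℂ)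

/-- The gauge-covariant derivative `D_μ u^a = ∂_μ u^a + f^{abc} A_μ^b u^c` of an adjoint-valued
function `u`, for the gauge potential `A`. -/
def covD (e : Module.Basis ι ℝ 𝔤) {d : ℕ} (A : Fin d → ι → SmoothFn d) (μ : Fin d)
    (u : ι → SmoothFn d) : ι → SmoothFn d :=
  fun a => pd μ (u a) + ∑ b, ∑ c, structConst e a b c • (A μ b * u c)

/-- The field strength `F_{μν}^a = ∂_μ A_ν^a - ∂_ν A_μ^a + f^{abc} A_μ^b A_ν^c`. -/
def fieldStrength (e : Module.Basis ι ℝ 𝔤) {d : ℕ} (A : Fin d → ι → SmoothFn d) (μ ν : Fin d) :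
    ι → SmoothFn d :=
  fun a => pd μ (A ν a) - pd ν (A μ a) + ∑ b, ∑ c, structConst e a b c • (A μ b * A ν c)

/-- The divergence `D^μ a_μ^a` of a perturbation `a_μ^a`. -/
def lorenz (e : Module.Basis ι ℝ 𝔤) {d : ℕ} (A a : Fin d → ι → SmoothFn d) : ι → SmoothFn d :=
  ∑ μ, eta μ • covD e A μ (a μ)

/-- The linearised Yang–Mills operator
`D^μ D_μ a_ν^a + 2 f^{abc} a^{b μ} F_{μν}^c`. -/
def linYM (e : Module.Basis ι ℝ 𝔤) {d : ℕ} (A a : Fin d → ι → SmoothFn d) (ν : Fin d) :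
    ι → SmoothFn d :=
  fun i => ∑ μ, eta μ • covD e A μ (covD e A μ (a ν)) i +
    (2 : ℂ) • ∑ b, ∑ c, structConst e i b c • ∑ μ, eta μ • (a μ b * fieldStrength e A μ ν c)

end YangMills

/-! ### The state space

Modes of every field `Φ` are numbered by `Φ(z) = ∑_n Φ_(n) z^{-n-1}`, whatever its conformal
weight.  With this numbering an OPE `Φ(z) Ψ(w) ∼ 1 / (z - w)` of free fields reads
`[Φ_(m), Ψ_(n)} = δ_{m+n,-1}`, and a current algebra at level zero reads
`[j^a_(m), j^b_(n)] = f^{abc} j^c_(m+n)`.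

The sector in question is the one with picture number `-1` of the Neveu–Schwarz sector: its vacuum
`|δ(γ)⟩` is the state of the operator `δ(γ)`.  It is annihilated by `γ_(n)` for `n ≥ -1` (since
`γ(z) δ(γ)(0) = O(z)`), by `β_(n)` for `n ≥ 1` (since `β(z) δ(γ)(0) = O(1/z)`), and by the modes
`n ≥ 0` of all other fields. -/

/-- The bosonic creation modes other than the zero mode of `X`: `x μ k` is `X^μ_(-k-2)`, `p μ k` is
`Π_{μ (-k-1)}`, `γ k` is `γ_(-k-2)` and `β k` is `β_(-k)`. -/
inductive BMode (d : ℕ) : Type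
  | x (μ : Fin d) (k : ℕ)
  | p (μ : Fin d) (k : ℕ)
  | γ (k : ℕ)
  | β (k : ℕ)

/-- The fermionic creation modes: `ψ μ k` is `ψ^μ_(-k-1)`, and `c k`, `b k`, `cbar k`, `bbar k` are
the modes `(-k-1)` of the ghosts `c`, `b`, `c̄`, `b̄`. -/
inductive FMode (d : ℕ) : Type
  | ψ (μ : Fin d) (k : ℕ)
  | c (k : ℕ)
  | b (k : ℕ)
  | cbar (k : ℕ)
  | bbar (k : ℕ)

/-- Polynomials in the bosonic creation modes. -/
abbrev Bos (d : ℕ) : Type := MvPolynomial (BMode d) ℂ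

/-- Exterior algebra on the fermionic creation modes. -/
abbrev Fer (d : ℕ) : Type := ExteriorAlgebra ℂ (FMode d →₀ ℂ)

section States

variable (𝔤 : Type*) [LieRing 𝔤] [LieAlgebra ℝ 𝔤]

/-- The loop algebra `𝔤_ℂ ⊗ ℂ[t, t⁻¹]` of the complexification of `𝔤`. -/
abbrev Loop : Type _ := LieAlgebra.loopAlgebra ℂ ℤ (ℂ ⊗[ℝ] 𝔤)

variable {𝔤} in
/-- The element `x t^n` of the loop algebra. -/
def loopElt (x : 𝔤) (n : ℤ) : Loop 𝔤 := AddMonoidAlgebra.single n 1 ⊗ₜ[ℂ] ((1 : ℂ) ⊗ₜ[ℝ] x)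

abbrev LoopU : Type _ := UniversalEnvelopingAlgebra ℂ (Loop 𝔤)

/-- The left ideal generated by the modes `x t^n` with `n ≥ 0`. -/
def annihIdeal : Submodule (LoopU 𝔤) (LoopU 𝔤) :=
  Submodule.span (LoopU 𝔤)
    {u | ∃ (x : 𝔤) (n : ℕ), u = UniversalEnvelopingAlgebra.ι ℂ (loopElt x (n : ℤ))}

/-- The state space of the current algebra at level zero: the vacuum module, generated by a vector
that is annihilated by all `j_(n)` with `n ≥ 0`, with no other relations than the current algebra
`[j^a_(m), j^b_(n)] = f^{abc} j^c_(m+n)`. -/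
def Cur : Type _ := LoopU 𝔤 ⧸ annihIdeal 𝔤

instance : AddCommGroup (Cur 𝔤) := inferInstanceAs (AddCommGroup (LoopU 𝔤 ⧸ annihIdeal 𝔤))

instance : Module (LoopU 𝔤) (Cur 𝔤) := inferInstanceAs (Module (LoopU 𝔤) (LoopU 𝔤 ⧸ annihIdeal 𝔤))

instance : Module ℂ (Cur 𝔤) := inferInstanceAs (Module ℂ (LoopU 𝔤 ⧸ annihIdeal 𝔤))

instance : IsScalarTower ℂ (LoopU 𝔤) (Cur 𝔤) :=
  inferInstanceAs (IsScalarTower ℂ (LoopU 𝔤) (LoopU 𝔤 ⧸ annihIdeal 𝔤))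

/-- The vacuum vector of the current algebra. -/
def curVac : Cur 𝔤 := (Submodule.Quotient.mk 1 : LoopU 𝔤 ⧸ annihIdeal 𝔤)

/-- The state space: smooth functions of the zero mode of `X`, times the Fock spaces of the other
modes, times the vacuum module of the current algebra. -/
abbrev State (d : ℕ) : Type _ := SmoothFn d ⊗[ℂ] (Bos d ⊗[ℂ] (Fer d ⊗[ℂ] Cur 𝔤))

instance (d : ℕ) : AddCommGroup (State 𝔤 d) := TensorProduct.addCommGroup

instance (d : ℕ) : Module ℂ (State 𝔤 d) := TensorProduct.leftModule

/-- The state of the operator `f(X) δ(γ)`. -/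
def fnState {d : ℕ} (f : SmoothFn d) : State 𝔤 d :=
  f ⊗ₜ[ℂ] ((1 : Bos d) ⊗ₜ[ℂ] ((1 : Fer d) ⊗ₜ[ℂ] curVac 𝔤))

/-- A field `Φ(z) = ∑_n Φ_(n) z^{-n-1}`, given by its modes. -/
abbrev WField (d : ℕ) : Type _ := ℤ → State 𝔤 d → State 𝔤 d

variable {𝔤} {d : ℕ}

/-! ### The operations on fields -/

/-- The worldsheet derivative `∂Φ`. -/
def del (Φ : WField 𝔤 d) : WField 𝔤 d := fun n v => (-(n : ℂ)) • Φ (n - 1) v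

/-- The point-splitting normal ordered product of `Φ` and `Ψ`, with sign `s = -1` if both are
fermionic and `s = 1` otherwise:
`(ΦΨ)_(n) = ∑_{m<0} Φ_(m) Ψ_(n-m-1) + s ∑_{m≥0} Ψ_(n-m-1) Φ_(m)`.
On each state only finitely many terms are nonzero. -/
def nopSign (s : ℂ) (Φ Ψ : WField 𝔤 d) : WField 𝔤 d := fun n v =>
  ∑ᶠ m : ℤ, if m < 0 then Φ m (Ψ (n - m - 1) v) else s • Ψ (n - m - 1) (Φ m v)

/-- Normal ordered product of two fields at least one of which is bosonic. -/
def nop (Φ Ψ : WField 𝔤 d) : WField 𝔤 d := nopSign 1 Φ Ψ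

/-- Normal ordered product of two fermionic fields. -/
def nopF (Φ Ψ : WField 𝔤 d) : WField 𝔤 d := nopSign (-1) Φ Ψ

/-! ### The elementary fields -/

def onFn (T : Module.End ℂ (SmoothFn d)) : Module.End ℂ (State 𝔤 d) :=
  LinearMap.rTensor _ T

def onBos (T : Module.End ℂ (Bos d)) : Module.End ℂ (State 𝔤 d) :=
  LinearMap.lTensor _ (LinearMap.rTensor _ T)

def onFer (T : Module.End ℂ (Fer d)) : Module.End ℂ (State 𝔤 d) :=
  LinearMap.lTensor _ (LinearMap.lTensor _ (LinearMap.rTensor _ T))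

def onCur (T : Module.End ℂ (Cur 𝔤)) : Module.End ℂ (State 𝔤 d) :=
  LinearMap.lTensor _ (LinearMap.lTensor _ (LinearMap.lTensor _ T))

/-- Multiplication by a smooth function of the zero mode of `X`. -/
def mulFn (f : SmoothFn d) : Module.End ℂ (State 𝔤 d) := onFn (LinearMap.mulLeft ℂ f)

/-- Multiplication by a bosonic creation mode. -/
def bCre (i : BMode d) : Module.End ℂ (State 𝔤 d) :=
  onBos (LinearMap.mulLeft ℂ (MvPolynomial.X i))

/-- Derivative with respect to a bosonic creation mode. -/
def bAnn (i : BMode d) : Module.End ℂ (State 𝔤 d) :=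
  onBos (MvPolynomial.pderiv i).toLinearMap

/-- Exterior multiplication by a fermionic creation mode. -/
def fCre (i : FMode d) : Module.End ℂ (State 𝔤 d) :=
  onFer (LinearMap.mulLeft ℂ (ExteriorAlgebra.ι ℂ (Finsupp.single i 1)))

/-- Contraction with (the dual of) a fermionic creation mode. -/
def fAnn (i : FMode d) : Module.End ℂ (State 𝔤 d) :=
  onFer (CliffordAlgebra.contractLeft (Q := (0 : QuadraticForm ℂ (FMode d →₀ ℂ)))
    (Finsupp.lapply i))

/-- The modes of `X^μ`. -/
def fX (μ : Fin d) : WField 𝔤 d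
  | Int.negSucc 0, v => mulFn (coordFn μ) v
  | Int.negSucc (k + 1), v => bCre (.x μ k) v
  | Int.ofNat n, v => bAnn (.p μ n) v

/-- The modes of `Π_μ`, with `X^μ(z) Π_ν(w) ∼ δ^μ_ν / (z - w)`. -/
def fPi (μ : Fin d) : WField 𝔤 d
  | Int.negSucc k, v => bCre (.p μ k) v
  | Int.ofNat 0, v => -(onFn (pd μ) v)
  | Int.ofNat (n + 1), v => -(bAnn (.x μ n) v)

/-- The modes of `ψ^μ`, with `ψ^μ(z) ψ^ν(w) ∼ η^{μν} / (z - w)`. -/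
def fPsi (μ : Fin d) : WField 𝔤 d
  | Int.negSucc k, v => fCre (.ψ μ k) v
  | Int.ofNat n, v => eta μ • fAnn (.ψ μ n) v

/-- The modes of `c`, with `c(z) b(w) ∼ 1 / (z - w)`. -/
def fC : WField 𝔤 d
  | Int.negSucc k, v => fCre (.c k) v
  | Int.ofNat n, v => fAnn (.b n) v

/-- The modes of `b`. -/
def fB : WField 𝔤 d
  | Int.negSucc k, v => fCre (.b k) v
  | Int.ofNat n, v => fAnn (.c n) v

/-- The modes of `c̄`, with `c̄(z) b̄(w) ∼ 1 / (z - w)`. -/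
def fCbar : WField 𝔤 d
  | Int.negSucc k, v => fCre (.cbar k) v
  | Int.ofNat n, v => fAnn (.bbar n) v

/-- The modes of `b̄`. -/
def fBbar : WField 𝔤 d
  | Int.negSucc k, v => fCre (.bbar k) v
  | Int.ofNat n, v => fAnn (.cbar n) v

/-- The modes of `γ` in picture number `-1`, with `γ(z) β(w) ∼ 1 / (z - w)`. -/
def fGamma : WField 𝔤 d
  | Int.negSucc 0, v => bAnn (.β 0) v
  | Int.negSucc (k + 1), v => bCre (.γ k) v
  | Int.ofNat n, v => bAnn (.β (n + 1)) v

/-- The modes of `β` in picture number `-1`. -/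
def fBeta : WField 𝔤 d
  | Int.negSucc k, v => bCre (.β (k + 1)) v
  | Int.ofNat 0, v => bCre (.β 0) v
  | Int.ofNat (n + 1), v => -(bAnn (.γ n) v)

/-- The modes of the current `j(x)` for `x` in `𝔤`; the current `j^a` is `fJ (e a)`. -/
def fJ (x : 𝔤) : WField 𝔤 d := fun n v =>
  onCur (Algebra.lsmul ℂ ℂ (Cur 𝔤) (UniversalEnvelopingAlgebra.ι ℂ (loopElt x n))) v

/-- The field `f(X(z))` for a smooth function `f`, by Taylor expansion around the zero mode `x`:
`f(X(z)) = ∑_N (1/N!) ∑_{μ₁,…,μ_N} (∂_{μ₁} ⋯ ∂_{μ_N} f)(x) ξ^{μ₁}(z) ⋯ ξ^{μ_N}(z)`, where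
`ξ^μ(z) = X^μ(z) - x^μ = ∑_{k ≠ -1} X^μ_(k) z^{-k-1}` (all modes of `X` commute).  The list `l`
holds the pairs `(μ_i, k_i)`; the mode `n` collects the terms with `∑_i (-k_i - 1) = -n - 1`.
On each state only finitely many terms are nonzero. -/
def fFn (f : SmoothFn d) : WField 𝔤 d := fun n v =>
  ∑ᶠ l : List (Fin d × ℤ),
    if (∀ q ∈ l, q.2 ≠ -1) ∧ (l.map fun q => -q.2 - 1).sum = -n - 1 then
      ((l.length.factorial : ℂ)⁻¹) •
        mulFn (l.foldr (fun q g => pd q.1 g) f) (l.foldr (fun q w => fX q.1 q.2 w) v)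
    else 0

end States

/-! ### The heterotic ambitwistor string on a gauge background -/

section Model

variable {𝔤 ι : Type*} [LieRing 𝔤] [LieAlgebra ℝ 𝔤] [Fintype ι] (e : Module.Basis ι ℝ 𝔤)
  {d : ℕ}

/-- The current `G = ψ^μ (Π_μ - A_μ^a j^a)`. -/
def curG (A : Fin d → ι → SmoothFn d) : WField 𝔤 d :=
  ∑ μ, nop (fPsi μ) (fPi μ - ∑ a, nop (fFn (A μ a)) (fJ (e a)))

/-- The current
`H = Π² - 2 Π^μ A_μ^a j^a + A_μ^a A^{μ b} j^a j^b + ψ^μ ψ^ν F_{μν}^a j^a - ∂(∂_μ A^{μ a} j^a)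
  + f^{abc} j^c A^{μ b} ∂A_μ^a`. -/
def curH (A : Fin d → ι → SmoothFn d) : WField 𝔤 d :=
  (∑ μ, eta μ • nop (fPi μ) (fPi μ))
  - (2 : ℂ) • (∑ μ, eta μ • ∑ a, nop (fPi μ) (nop (fFn (A μ a)) (fJ (e a))))
  + (∑ μ, eta μ • ∑ a, ∑ b, nop (fFn (A μ a * A μ b)) (nop (fJ (e a)) (fJ (e b))))
  + (∑ μ, ∑ ν, ∑ a,
      nop (nopF (fPsi μ) (fPsi ν)) (nop (fFn (fieldStrength e A μ ν a)) (fJ (e a))))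
  - del (∑ μ, eta μ • ∑ a, nop (fFn (pd μ (A μ a))) (fJ (e a)))
  + ∑ a, ∑ b, ∑ c, structConst e a b c •
      ∑ μ, eta μ • nop (fJ (e c)) (nop (fFn (A μ b)) (del (fFn (A μ a))))

/-- The stress tensor of all fields except `(b, c)`:
`T = -Π_μ ∂X^μ - ½ ψ_μ ∂ψ^μ + T_C + (c̄ ∂b̄ - 2 b̄ ∂c̄) + (-(3/2) β ∂γ - ½ γ ∂β)`.
Here `T_C = -(1/C) j^a j^a` is the Sugawara stress tensor of the current algebra at level zero,
`C` being given by `f^{acd} f^{bcd} = C δ^{ab}`. -/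
def stressT (C : ℝ) : WField 𝔤 d :=
  -(∑ μ, nop (fPi μ) (del (fX μ)))
  - (1 / 2 : ℂ) • (∑ μ, eta μ • nopF (fPsi μ) (del (fPsi μ)))
  - ((C : ℂ)⁻¹) • (∑ a, nop (fJ (e a)) (fJ (e a)))
  + (nopF fCbar (del fBbar) - (2 : ℂ) • nopF fBbar (del fCbar))
  + (-((3 / 2 : ℂ) • nop fBeta (del fGamma)) - (1 / 2 : ℂ) • nop fGamma (del fBeta))

/-- The BRST operator `Q = ∮ c T + b c ∂c + γ G + c̄ H - ½ b̄ γ²` in the gauge background `A`. -/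
def brstQ (C : ℝ) (A : Fin d → ι → SmoothFn d) : State 𝔤 d → State 𝔤 d :=
  (show WField 𝔤 d from nop fC (stressT e C) + nop fB (nopF fC (del fC)) + nop fGamma (curG e A)
    + nop fCbar (curH e A) - (1 / 2 : ℂ) • nop fBbar (nop fGamma fGamma)) 0

/-- The (state of the) fixed gluon vertex operator `V = c c̄ δ(γ) ψ^μ a_μ^a j^a`. -/
def gluonV (a : Fin d → ι → SmoothFn d) : State 𝔤 d :=
  ∑ μ, ∑ i, fC (-1) (fCbar (-1) (fPsi μ (-1) (fJ (e i) (-1) (fnState 𝔤 (a μ i)))))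

end Model

end Ambitwistor

end

/-! Write `Φ_(n)` for the modes of a field. `Q` is the zero mode of a sum of normal ordered
products, and `V` is so close to the vacuum that every infinite mode sum collapses. Consider a
product of a ghost (`c`, `γ` or `c̄`) with its partner (`T`, `G` or `H`). On `V` the ghost modes
with index at least -1 vanish, and so do the partner modes with index at least 2. What survives is
the ghost mode -2 times the partner mode 1, and the ghost mode -1 times the partner mode 0. The
second term vanishes as well: the partner contains no field conjugate to that ghost, so its modes
preserve the kernel of the ghost mode -1 (`ghostStable_ker_fCre_c`, `matterStable_ker_bAnn_beta`,
`matterStable_ker_fCre`). The term `b̄ γ²` gives nothing.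

Three mode-one computations remain. First, `T_(1) V = V` (`stressT_gluonV`): the weights are 1/2
from `ψ`, 1 from `j` through the adjoint Casimir, -1 from `c̄` and 1/2 from `δ(γ)`. The resulting
`c_(-2) V` cancels against the contribution of `b c ∂c`. Next, `Π_(0)` acts as `-∂` and `j_(0)` acts
in the adjoint representation on `j_(-1)`, so the zero modes combine into the covariant derivative
(`covOp_multiplet`). Hence `G_(1)`, which contracts the single `ψ`, gives minus the covariant
divergence (`curG_gluonV`), while `H_(1)` is the covariant d'Alembertian plus the spin coupling to
`F` (`curH_gluonV`).

For the equivalence, the ghost and `ψ` oscillators are stripped off by contractions and derivatives,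
which leaves the claim that `∑ j^a_(-1) u^a = 0` on the vacuum forces `u = 0`. This needs the vacuum
module to be nontrivial in degree one. The loop algebra acts by Riccati vector fields on the big
cell of a Grassmannian of loops. Nonnegative modes vanish at the origin, so the vacuum module maps
to distributions with the vacuum going to the delta function. Testing `j(x)_(-1)` on a suitable
coordinate reads off a matrix entry of `ad x`, and `f^{acd} f^{bcd} = C δ^{ab}` then recovers `u`
(`eq_zero_of_multiplet_eq_zero`). -/

noncomputable section

namespace Ambitwistor

/-! ### Operators on the four tensor factors and their commutation relations. -/

section Slots

attribute [local instance 100] LieRing.ofAssociativeRing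

variable {𝔤 : Type*} [LieRing 𝔤] [LieAlgebra ℝ 𝔤] {d : ℕ}

theorem State.hom_ext {M : Type*} [AddCommGroup M] [Module ℂ M] {S T : State 𝔤 d →ₗ[ℂ] M}
    (h : ∀ f p w u, S (f ⊗ₜ[ℂ] (p ⊗ₜ[ℂ] (w ⊗ₜ[ℂ] u))) = T (f ⊗ₜ[ℂ] (p ⊗ₜ[ℂ] (w ⊗ₜ[ℂ] u)))) :
    S = T := by
  refine TensorProduct.ext' fun f x => ?_
  induction x with
  | zero => simp
  | add x y hx hy => simp only [TensorProduct.tmul_add, map_add, hx, hy]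
  | tmul p y =>
    induction y with
    | zero => simp
    | add x y hx hy => simp only [TensorProduct.tmul_add, map_add, hx, hy]
    | tmul w u => exact h f p w u

section Apply

variable (f : SmoothFn d) (p : Bos d) (w : Fer d) (u : Cur 𝔤)

@[simp] theorem onFn_tmul (T : Module.End ℂ (SmoothFn d)) :
    onFn T (f ⊗ₜ[ℂ] (p ⊗ₜ[ℂ] (w ⊗ₜ[ℂ] u)) : State 𝔤 d) = T f ⊗ₜ[ℂ] (p ⊗ₜ[ℂ] (w ⊗ₜ[ℂ] u)) := by
  simp only [onFn, LinearMap.rTensor_tmul]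

@[simp] theorem onBos_tmul (T : Module.End ℂ (Bos d)) :
    onBos T (f ⊗ₜ[ℂ] (p ⊗ₜ[ℂ] (w ⊗ₜ[ℂ] u)) : State 𝔤 d) = f ⊗ₜ[ℂ] (T p ⊗ₜ[ℂ] (w ⊗ₜ[ℂ] u)) := by
  simp only [onBos, LinearMap.lTensor_tmul, LinearMap.rTensor_tmul]

@[simp] theorem onFer_tmul (T : Module.End ℂ (Fer d)) :
    onFer T (f ⊗ₜ[ℂ] (p ⊗ₜ[ℂ] (w ⊗ₜ[ℂ] u)) : State 𝔤 d) = f ⊗ₜ[ℂ] (p ⊗ₜ[ℂ] (T w ⊗ₜ[ℂ] u)) := by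
  simp only [onFer, LinearMap.lTensor_tmul, LinearMap.rTensor_tmul]

@[simp] theorem onCur_tmul (T : Module.End ℂ (Cur 𝔤)) :
    onCur T (f ⊗ₜ[ℂ] (p ⊗ₜ[ℂ] (w ⊗ₜ[ℂ] u)) : State 𝔤 d) = f ⊗ₜ[ℂ] (p ⊗ₜ[ℂ] (w ⊗ₜ[ℂ] T u)) := by
  simp only [onCur, LinearMap.lTensor_tmul]

end Apply

theorem onFn_onBos (S : Module.End ℂ (SmoothFn d)) (T : Module.End ℂ (Bos d)) :
    Commute (onFn S : Module.End ℂ (State 𝔤 d)) (onBos T) := 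
  State.hom_ext fun _ _ _ _ => by
    simp only [Module.End.mul_apply, onFn_tmul, onBos_tmul]

theorem onFn_onFer (S : Module.End ℂ (SmoothFn d)) (T : Module.End ℂ (Fer d)) :
    Commute (onFn S : Module.End ℂ (State 𝔤 d)) (onFer T) := 
  State.hom_ext fun _ _ _ _ => by
    simp only [Module.End.mul_apply, onFn_tmul, onFer_tmul]

theorem onFn_onCur (S : Module.End ℂ (SmoothFn d)) (T : Module.End ℂ (Cur 𝔤)) :
    Commute (onFn S : Module.End ℂ (State 𝔤 d)) (onCur T) := 
  State.hom_ext fun _ _ _ _ => by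
    simp only [Module.End.mul_apply, onFn_tmul, onCur_tmul]

theorem onBos_onFer (S : Module.End ℂ (Bos d)) (T : Module.End ℂ (Fer d)) :
    Commute (onBos S : Module.End ℂ (State 𝔤 d)) (onFer T) := 
  State.hom_ext fun _ _ _ _ => by
    simp only [Module.End.mul_apply, onBos_tmul, onFer_tmul]

theorem onBos_onCur (S : Module.End ℂ (Bos d)) (T : Module.End ℂ (Cur 𝔤)) :
    Commute (onBos S : Module.End ℂ (State 𝔤 d)) (onCur T) := 
  State.hom_ext fun _ _ _ _ => by
    simp only [Module.End.mul_apply, onBos_tmul, onCur_tmul]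

theorem onFer_onCur (S : Module.End ℂ (Fer d)) (T : Module.End ℂ (Cur 𝔤)) :
    Commute (onFer S : Module.End ℂ (State 𝔤 d)) (onCur T) := 
  State.hom_ext fun _ _ _ _ => by
    simp only [Module.End.mul_apply, onFer_tmul, onCur_tmul]

variable (v : State 𝔤 d)

/-! ### Canonical (anti)commutation relations -/

theorem bAnn_bCre_of_ne {i j : BMode d} (h : j ≠ i) :
    bAnn i (bCre j v) = bCre j (bAnn i v) := by
  refine LinearMap.congr_fun (f := bAnn i ∘ₗ bCre j) (g := bCre j ∘ₗ bAnn i)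
    (State.hom_ext fun f p w u => ?_) v
  simp [bAnn, bCre, Derivation.leibniz, MvPolynomial.pderiv_X_of_ne h]

theorem bAnn_bCre_self (i : BMode d) : bAnn i (bCre i v) = v + bCre i (bAnn i v) := by
  refine LinearMap.congr_fun (f := bAnn i ∘ₗ bCre i) (g := LinearMap.id + bCre i ∘ₗ bAnn i)
    (State.hom_ext fun f p w u => ?_) v
  simp [bAnn, bCre, Derivation.leibniz, TensorProduct.tmul_add, TensorProduct.add_tmul, add_comm]

theorem fAnn_fCre_self (i : FMode d) : fAnn i (fCre i v) = v - fCre i (fAnn i v) := by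
  refine LinearMap.congr_fun (f := fAnn i ∘ₗ fCre i) (g := LinearMap.id - fCre i ∘ₗ fAnn i)
    (State.hom_ext fun f p w u => ?_) v
  have := CliffordAlgebra.contractLeft_ι_mul (Q := (0 : QuadraticForm ℂ (FMode d →₀ ℂ)))
    (d := Finsupp.lapply i) (Finsupp.single i 1) w
  simp only [LinearMap.comp_apply, fAnn, fCre, onFer_tmul, LinearMap.mulLeft_apply, this,
    ExteriorAlgebra.ι, LinearMap.sub_apply, LinearMap.id_apply, Finsupp.lapply_apply,
    Finsupp.single_eq_same, one_smul, TensorProduct.sub_tmul, TensorProduct.tmul_sub]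

theorem fAnn_fCre_of_ne {i j : FMode d} (h : j ≠ i) :
    fAnn i (fCre j v) = -fCre j (fAnn i v) := by
  refine LinearMap.congr_fun (f := fAnn i ∘ₗ fCre j) (g := -(fCre j ∘ₗ fAnn i))
    (State.hom_ext fun f p w u => ?_) v
  have := CliffordAlgebra.contractLeft_ι_mul (Q := (0 : QuadraticForm ℂ (FMode d →₀ ℂ)))
    (d := Finsupp.lapply i) (Finsupp.single j 1) w
  simp only [LinearMap.comp_apply, fAnn, fCre, onFer_tmul, LinearMap.mulLeft_apply, this,
    ExteriorAlgebra.ι, LinearMap.neg_apply, Finsupp.lapply_apply,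
    Finsupp.single_eq_of_ne h.symm, zero_smul, zero_sub, TensorProduct.neg_tmul,
    TensorProduct.tmul_neg]

theorem fAnn_fAnn (i j : FMode d) : fAnn i (fAnn j v) = -fAnn j (fAnn i v) := by
  refine LinearMap.congr_fun (f := fAnn i ∘ₗ fAnn j) (g := -(fAnn j ∘ₗ fAnn i))
    (State.hom_ext fun f p w u => ?_) v
  have := CliffordAlgebra.contractLeft_comm (Q := (0 : QuadraticForm ℂ (FMode d →₀ ℂ)))
    (d := Finsupp.lapply i) (d' := Finsupp.lapply j) w
  simp only [LinearMap.comp_apply, fAnn, onFer_tmul, this, LinearMap.neg_apply,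
    TensorProduct.neg_tmul, TensorProduct.tmul_neg]

theorem fCre_fCre (i j : FMode d) : fCre i (fCre j v) = -fCre j (fCre i v) := by
  refine LinearMap.congr_fun (f := fCre i ∘ₗ fCre j) (g := -(fCre j ∘ₗ fCre i))
    (State.hom_ext fun f p w u => ?_) v
  have := CliffordAlgebra.ι_mul_ι_add_swap (Q := (0 : QuadraticForm ℂ (FMode d →₀ ℂ)))
    (Finsupp.single i 1) (Finsupp.single j 1)
  have h : ExteriorAlgebra.ι ℂ (Finsupp.single i 1) * (ExteriorAlgebra.ι ℂ (Finsupp.single j 1) * w)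
      = -(ExteriorAlgebra.ι ℂ (Finsupp.single j 1) *
        (ExteriorAlgebra.ι ℂ (Finsupp.single i 1) * w) : Fer d) := by
    rw [← mul_assoc, ← mul_assoc, ← neg_mul, ← add_eq_zero_iff_eq_neg.mp]
    simp [ExteriorAlgebra.ι, QuadraticMap.polar, this]
  simp only [LinearMap.comp_apply, fCre, onFer_tmul, LinearMap.neg_apply, LinearMap.mulLeft_apply,
    h, TensorProduct.neg_tmul, TensorProduct.tmul_neg]

theorem eq_zero_of_eq_neg {v : State 𝔤 d} (h : v = -v) : v = 0 := by
  have h2 : (2 : ℂ) • v = 0 := by rw [two_smul]; nth_rewrite 1 [h]; exact neg_add_cancel v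
  simpa using congrArg ((2 : ℂ)⁻¹ • ·) h2

theorem fCre_self (i : FMode d) : fCre i (fCre i v) = 0 :=
  eq_zero_of_eq_neg (fCre_fCre v i i)

/-! ### The current algebra -/

/-- The modes of the current `j(x)` as linear operators. -/
def opJ (x : 𝔤) (n : ℤ) : Module.End ℂ (State 𝔤 d) :=
  onCur (Algebra.lsmul ℂ ℂ (Cur 𝔤) (UniversalEnvelopingAlgebra.ι ℂ (loopElt x n)))

theorem fJ_eq (x : 𝔤) (n : ℤ) : fJ x n v = opJ x n v := rfl

theorem lie_loopElt (x y : 𝔤) (m n : ℤ) :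
    ⁅loopElt x m, loopElt y n⁆ = loopElt ⁅x, y⁆ (m + n) := by
  rw [loopElt, loopElt, LieAlgebra.ExtendScalars.bracket_tmul,
    LieAlgebra.ExtendScalars.bracket_tmul, AddMonoidAlgebra.single_mul_single, one_mul, loopElt]

theorem opJ_opJ (x y : 𝔤) (m n : ℤ) :
    opJ x m (opJ y n v) = opJ y n (opJ x m v) + opJ ⁅x, y⁆ (m + n) v := by
  refine LinearMap.congr_fun (f := opJ x m ∘ₗ opJ y n)
    (g := opJ y n ∘ₗ opJ x m + opJ ⁅x, y⁆ (m + n)) (State.hom_ext fun f p w u => ?_) v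
  have h : UniversalEnvelopingAlgebra.ι ℂ (loopElt x m) *
        UniversalEnvelopingAlgebra.ι ℂ (loopElt y n) =
      UniversalEnvelopingAlgebra.ι ℂ (loopElt y n) * UniversalEnvelopingAlgebra.ι ℂ (loopElt x m) +
      UniversalEnvelopingAlgebra.ι ℂ (loopElt ⁅x, y⁆ (m + n)) := by
    rw [← lie_loopElt, LieHom.map_lie, LieRing.of_associative_ring_bracket, add_sub_cancel]
  simp only [LinearMap.comp_apply, opJ, onCur_tmul, LinearMap.add_apply, Algebra.lsmul_coe,
    ← mul_smul, h, add_smul, TensorProduct.tmul_add]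

theorem loopElt_smul_add (r : ℝ) (x y : 𝔤) (n : ℤ) :
    loopElt (r • x + y) n = (r : ℂ) • loopElt x n + loopElt y n := by
  rw [loopElt, TensorProduct.tmul_add, TensorProduct.tmul_add, loopElt, loopElt,
    TensorProduct.tmul_smul, ← TensorProduct.tmul_smul (r : ℂ), Complex.coe_smul]
  rfl

theorem opJ_smul_add (r : ℝ) (x y : 𝔤) (n : ℤ) :
    opJ (r • x + y) n v = (r : ℂ) • opJ x n v + opJ y n v := by
  suffices h : opJ (r • x + y) n = (r : ℂ) • (opJ x n : Module.End ℂ (State 𝔤 d)) + opJ y n from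
    LinearMap.congr_fun h v
  refine State.hom_ext fun f p w u => ?_
  have h : UniversalEnvelopingAlgebra.ι ℂ (loopElt (r • x + y) n) • u =
      (r : ℂ) • (UniversalEnvelopingAlgebra.ι ℂ (loopElt x n) • u) +
        UniversalEnvelopingAlgebra.ι ℂ (loopElt y n) • u := by
    rw [loopElt_smul_add, map_add, map_smul, add_smul, smul_assoc]
  simp only [opJ, onCur_tmul, LinearMap.add_apply, Algebra.lsmul_coe, LinearMap.smul_apply, h,
    TensorProduct.tmul_add]
  rw [TensorProduct.tmul_smul (r : ℂ) w, TensorProduct.tmul_smul (r : ℂ) p,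
    TensorProduct.tmul_smul (r : ℂ) f]

theorem opJ_zero (n : ℤ) : opJ (0 : 𝔤) n v = 0 := by
  have := opJ_smul_add v 1 (0 : 𝔤) 0 n
  simpa using this

theorem opJ_sum {κ : Type*} (s : Finset κ) (r : κ → ℝ) (x : κ → 𝔤) (n : ℤ) :
    opJ (∑ k ∈ s, r k • x k) n v = ∑ k ∈ s, (r k : ℂ) • opJ (x k) n v := by
  classical
  induction s using Finset.induction_on with
  | empty => simp [opJ_zero]
  | insert a s ha ih => rw [Finset.sum_insert ha, opJ_smul_add, ih, Finset.sum_insert ha]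

theorem opJ_vac (x : 𝔤) (n : ℕ) (f : SmoothFn d) : opJ x n (fnState 𝔤 f) = 0 := by
  have h : (UniversalEnvelopingAlgebra.ι ℂ (loopElt x n) : LoopU 𝔤) • curVac 𝔤 = 0 := by
    refine (Submodule.Quotient.mk_eq_zero (annihIdeal 𝔤)).mpr ?_
    change _ * (1 : LoopU 𝔤) ∈ _
    rw [mul_one]
    exact Submodule.subset_span ⟨x, n, rfl⟩
  simp only [opJ, fnState, onCur_tmul, Algebra.lsmul_coe, h, TensorProduct.tmul_zero]

end Slots

/-! ### Invariant subspaces, collapse of normal ordered products, modes of `f(X)`. -/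

section Fields

variable {𝔤 : Type*} [LieRing 𝔤] [LieAlgebra ℝ 𝔤] {d : ℕ}

/-! ### Subspaces stable under all modes of a field -/

/-- Every mode of the field `Φ` maps the subspace `S` to itself. -/
def Stable (S : Submodule ℂ (State 𝔤 d)) (Φ : WField 𝔤 d) : Prop := ∀ n, ∀ v ∈ S, Φ n v ∈ S

variable {S : Submodule ℂ (State 𝔤 d)} {Φ Ψ : WField 𝔤 d}

theorem finsum_mem_submodule {κ : Type*} {f : κ → State 𝔤 d} (h : ∀ k, f k ∈ S) :
    ∑ᶠ k, f k ∈ S :=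
  finsum_induction (· ∈ S) S.zero_mem (fun _ _ => S.add_mem) h

namespace Stable

theorem nopSign (s : ℂ) (hΦ : Stable S Φ) (hΨ : Stable S Ψ) : Stable S (nopSign s Φ Ψ) := by
  intro n v hv
  refine finsum_mem_submodule fun m => ?_
  split_ifs
  · exact hΦ _ _ (hΨ _ _ hv)
  · exact S.smul_mem _ (hΨ _ _ (hΦ _ _ hv))

theorem nop (hΦ : Stable S Φ) (hΨ : Stable S Ψ) : Stable S (nop Φ Ψ) := nopSign 1 hΦ hΨ

theorem nopF (hΦ : Stable S Φ) (hΨ : Stable S Ψ) : Stable S (nopF Φ Ψ) := nopSign (-1) hΦ hΨ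

theorem add (hΦ : Stable S Φ) (hΨ : Stable S Ψ) : Stable S (Φ + Ψ) :=
  fun n v hv => S.add_mem (hΦ n v hv) (hΨ n v hv)

theorem sub (hΦ : Stable S Φ) (hΨ : Stable S Ψ) : Stable S (Φ - Ψ) :=
  fun n v hv => S.sub_mem (hΦ n v hv) (hΨ n v hv)

theorem neg (hΦ : Stable S Φ) : Stable S (-Φ) := fun n v hv => S.neg_mem (hΦ n v hv)

theorem smul (s : ℂ) (hΦ : Stable S Φ) : Stable S (s • Φ) :=
  fun n v hv => S.smul_mem s (hΦ n v hv)

theorem del (hΦ : Stable S Φ) : Stable S (del Φ) := fun n v hv => S.smul_mem _ (hΦ (n - 1) v hv)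

theorem sum {κ : Type*} [Fintype κ] {Φ : κ → WField 𝔤 d} (h : ∀ k, Stable S (Φ k)) :
    Stable S (∑ k, Φ k) := by
  intro n v hv
  simp only [Finset.sum_apply]
  exact S.sum_mem fun k _ => h k n v hv

theorem fFn (hX : ∀ μ, Stable S (fX μ)) (hM : ∀ f, ∀ v ∈ S, mulFn f v ∈ S) (f : SmoothFn d) :
    Stable S (fFn f) := by
  intro n v hv
  refine finsum_mem_submodule fun l => ?_
  split_ifs
  · refine S.smul_mem _ (hM _ _ ?_)
    clear * - hX hv
    induction l with
    | nil => exact hv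
    | cons q l ih => exact hX _ _ _ ih
  · exact S.zero_mem

/-- Fields are families of plain functions on states, with no linearity built in. Stability of `⊥`
is the part of linearity that truncating mode sums requires, and it is inherited by composite
fields. -/
theorem map_zero (h : Stable ⊥ Φ) (n : ℤ) : Φ n 0 = 0 := (Submodule.mem_bot ℂ).mp (h n 0 rfl)

end Stable

/-- The subspace is stable under the elementary fields `X`, `Π`, `ψ`, `j` and under multiplication
by functions of the zero mode. -/
structure MatterStable (S : Submodule ℂ (State 𝔤 d)) : Prop where
  mul : ∀ f, ∀ v ∈ S, mulFn f v ∈ S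
  x : ∀ μ, Stable S (fX μ)
  p : ∀ μ, Stable S (fPi μ)
  psi : ∀ μ, Stable S (fPsi μ)
  j : ∀ x, Stable S (fJ x)

/-- The subspace is moreover stable under the fields `c̄`, `b̄`, `γ`, `β`. -/
structure GhostStable (S : Submodule ℂ (State 𝔤 d)) : Prop extends MatterStable S where
  cbar : Stable S fCbar
  bbar : Stable S fBbar
  gamma : Stable S fGamma
  beta : Stable S fBeta

theorem MatterStable.fn (h : MatterStable S) (f : SmoothFn d) : Stable S (fFn f) :=
  Stable.fFn h.x h.mul f

section Currents

variable {ι : Type*} [Fintype ι] (e : Module.Basis ι ℝ 𝔤)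

theorem MatterStable.curG (h : MatterStable S) (A : Fin d → ι → SmoothFn d) :
    Stable S (curG e A) :=
  .sum fun μ => (h.psi μ).nop ((h.p μ).sub (.sum fun _ => (h.fn _).nop (h.j _)))

theorem MatterStable.curH (h : MatterStable S) (A : Fin d → ι → SmoothFn d) :
    Stable S (curH e A) :=
  .add (.sub (.add (.add (.sub
    (.sum fun μ => .smul _ ((h.p μ).nop (h.p μ)))
    (.smul _ (.sum fun μ => .smul _ (.sum fun _ => (h.p μ).nop ((h.fn _).nop (h.j _))))))
    (.sum fun _ => .smul _ (.sum fun _ => .sum fun _ => (h.fn _).nop ((h.j _).nop (h.j _)))))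
    (.sum fun μ => .sum fun ν => .sum fun _ =>
      ((h.psi μ).nopF (h.psi ν)).nop ((h.fn _).nop (h.j _))))
    (.del (.sum fun _ => .smul _ (.sum fun _ => (h.fn _).nop (h.j _)))))
    (.sum fun _ => .sum fun _ => .sum fun _ => .smul _ (.sum fun _ => .smul _
      ((h.j _).nop ((h.fn _).nop (.del (h.fn _))))))

theorem GhostStable.stressT (h : GhostStable S) (C : ℝ) : Stable S (stressT e C (d := d)) :=
  .add (.add (.sub (.sub
    (.neg (.sum fun μ => (h.p μ).nop (h.x μ).del))
    (.smul _ (.sum fun μ => .smul _ ((h.psi μ).nopF (h.psi μ).del))))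
    (.smul _ (.sum fun _ => (h.j _).nop (h.j _))))
    (.sub (h.cbar.nopF h.bbar.del) (.smul _ (h.bbar.nopF h.cbar.del))))
    (.sub (.neg (.smul _ (h.beta.nop h.gamma.del))) (.smul _ (h.gamma.nop h.beta.del)))

end Currents

/-! ### Stable subspaces -/

theorem ghostStable_bot : GhostStable (⊥ : Submodule ℂ (State 𝔤 d)) where
  mul f v hv := by simp [(Submodule.mem_bot ℂ).mp hv]
  x μ n v hv := by
    rw [(Submodule.mem_bot ℂ).mp hv]; rcases n with n | (_ | n) <;> simp [fX]
  p μ n v hv := by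
    rw [(Submodule.mem_bot ℂ).mp hv]; rcases n with (_ | n) | n <;> simp [fPi]
  psi μ n v hv := by
    rw [(Submodule.mem_bot ℂ).mp hv]; rcases n with n | n <;> simp [fPsi]
  j x n v hv := by
    rw [(Submodule.mem_bot ℂ).mp hv]; simp [fJ]
  cbar n v hv := by
    rw [(Submodule.mem_bot ℂ).mp hv]; rcases n with n | n <;> simp [fCbar]
  bbar n v hv := by
    rw [(Submodule.mem_bot ℂ).mp hv]; rcases n with n | n <;> simp [fBbar]
  gamma n v hv := by
    rw [(Submodule.mem_bot ℂ).mp hv]; rcases n with n | (_ | n) <;> simp [fGamma]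
  beta n v hv := by
    rw [(Submodule.mem_bot ℂ).mp hv]; rcases n with (_ | n) | n <;> simp [fBeta]

theorem stable_bot_c : Stable (⊥ : Submodule ℂ (State 𝔤 d)) fC := by
  intro n v hv
  rw [(Submodule.mem_bot ℂ).mp hv]; rcases n with n | n <;> simp [fC]

theorem stable_bot_b : Stable (⊥ : Submodule ℂ (State 𝔤 d)) fB := by
  intro n v hv
  rw [(Submodule.mem_bot ℂ).mp hv]; rcases n with n | n <;> simp [fB]

theorem mem_ker_of_commute {L T : Module.End ℂ (State 𝔤 d)} (h : Commute L T)
    {v : State 𝔤 d} (hv : v ∈ LinearMap.ker L) : T v ∈ LinearMap.ker L := by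
  rw [LinearMap.mem_ker] at hv ⊢
  rw [← Module.End.mul_apply, h.eq, Module.End.mul_apply, hv, map_zero]

theorem fCre_mem_ker {i : FMode d} (j : FMode d) {v : State 𝔤 d}
    (hv : v ∈ LinearMap.ker (fCre (𝔤 := 𝔤) i)) : fCre j v ∈ LinearMap.ker (fCre (𝔤 := 𝔤) i) := by
  rw [LinearMap.mem_ker] at hv ⊢
  rw [fCre_fCre, hv, map_zero, neg_zero]

theorem fAnn_mem_ker {i j : FMode d} (h : i ≠ j) {v : State 𝔤 d}
    (hv : v ∈ LinearMap.ker (fCre (𝔤 := 𝔤) i)) : fAnn j v ∈ LinearMap.ker (fCre (𝔤 := 𝔤) i) := by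
  rw [LinearMap.mem_ker] at hv ⊢
  rw [← neg_eq_zero, ← fAnn_fCre_of_ne _ h, hv, map_zero]

/-- Only contraction with the mode `i` itself fails to anticommute with `fCre i`, and the only
contractions among matter modes are those of `ψ`; hence the restriction on `i`. -/
theorem matterStable_ker_fCre {i : FMode d} (hi : ∀ μ k, i ≠ .ψ μ k) :
    MatterStable (LinearMap.ker (fCre (𝔤 := 𝔤) i)) where
  mul f v hv := mem_ker_of_commute (onFn_onFer _ _).symm hv
  x μ n v hv := by
    rcases n with n | (_ | n)
    · exact mem_ker_of_commute (onBos_onFer _ _).symm hv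
    · exact mem_ker_of_commute (onFn_onFer _ _).symm hv
    · exact mem_ker_of_commute (onBos_onFer _ _).symm hv
  p μ n v hv := by
    rcases n with (_ | n) | n
    · exact neg_mem (mem_ker_of_commute (onFn_onFer _ _).symm hv)
    · exact neg_mem (mem_ker_of_commute (onBos_onFer _ _).symm hv)
    · exact mem_ker_of_commute (onBos_onFer _ _).symm hv
  psi μ n v hv := by
    rcases n with n | n
    · exact Submodule.smul_mem _ _ (fAnn_mem_ker (hi _ _) hv)
    · exact fCre_mem_ker _ hv
  j x n v hv := mem_ker_of_commute (onFer_onCur _ _) hv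

/-- Contraction with a mode of `c` is a mode of `b`, which is absent from the stress tensor. This is
what kills `c_(-1) T_(0) V`. -/
theorem ghostStable_ker_fCre_c :
    GhostStable (LinearMap.ker (fCre (𝔤 := 𝔤) (d := d) (.c 0))) where
  toMatterStable := matterStable_ker_fCre (by simp)
  cbar n v hv := by
    rcases n with n | n
    · exact fAnn_mem_ker (by simp) hv
    · exact fCre_mem_ker _ hv
  bbar n v hv := by
    rcases n with n | n
    · exact fAnn_mem_ker (by simp) hv
    · exact fCre_mem_ker _ hv
  gamma n v hv := by
    rcases n with n | (_ | n) <;> exact mem_ker_of_commute (onBos_onFer _ _).symm hv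
  beta n v hv := by
    rcases n with (_ | n) | n
    · exact mem_ker_of_commute (onBos_onFer _ _).symm hv
    · exact neg_mem (mem_ker_of_commute (onBos_onFer _ _).symm hv)
    · exact mem_ker_of_commute (onBos_onFer _ _).symm hv

theorem pderiv_comm {σ : Type*} (i j : σ) (p : MvPolynomial σ ℂ) :
    MvPolynomial.pderiv i (MvPolynomial.pderiv j p) =
      MvPolynomial.pderiv j (MvPolynomial.pderiv i p) := by
  classical
  induction p using MvPolynomial.induction_on with
  | C a => simp
  | add p q hp hq => simp only [map_add, hp, hq]
  | mul_X p k hp =>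
    have h (i j : σ) : MvPolynomial.pderiv i (MvPolynomial.pderiv j (MvPolynomial.X k)) =
        (0 : MvPolynomial σ ℂ) := by
      rw [MvPolynomial.pderiv_X, Pi.single_apply]
      split_ifs <;> simp
    simp only [MvPolynomial.pderiv_mul, map_add, h, hp]
    ring

theorem bAnn_comm (i j : BMode d) (v : State 𝔤 d) : bAnn i (bAnn j v) = bAnn j (bAnn i v) := by
  refine LinearMap.congr_fun (f := bAnn i ∘ₗ bAnn j) (g := bAnn j ∘ₗ bAnn i)
    (State.hom_ext fun f p w u => ?_) v
  simp only [bAnn, LinearMap.comp_apply, onBos_tmul, Derivation.coeFn_coe, pderiv_comm i j]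

theorem bAnn_mem_ker {i : BMode d} (j : BMode d) {v : State 𝔤 d}
    (hv : v ∈ LinearMap.ker (bAnn (𝔤 := 𝔤) i)) : bAnn j v ∈ LinearMap.ker (bAnn (𝔤 := 𝔤) i) := by
  rw [LinearMap.mem_ker] at hv ⊢
  rw [bAnn_comm, hv, map_zero]

theorem bCre_mem_ker {i j : BMode d} (h : j ≠ i) {v : State 𝔤 d}
    (hv : v ∈ LinearMap.ker (bAnn (𝔤 := 𝔤) i)) : bCre j v ∈ LinearMap.ker (bAnn (𝔤 := 𝔤) i) := by
  rw [LinearMap.mem_ker] at hv ⊢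
  rw [bAnn_bCre_of_ne _ h, hv, map_zero]

/-- `bAnn (.β 0)` is `γ_(-1)`, which commutes with all matter modes. This is what kills `γ_(-1)
G_(0) V`. -/
theorem matterStable_ker_bAnn_beta :
    MatterStable (LinearMap.ker (bAnn (𝔤 := 𝔤) (d := d) (.β 0))) where
  mul f v hv := mem_ker_of_commute (onFn_onBos _ _).symm hv
  x μ n v hv := by
    rcases n with n | (_ | n)
    · exact bAnn_mem_ker _ hv
    · exact mem_ker_of_commute (onFn_onBos _ _).symm hv
    · exact bCre_mem_ker (by simp) hv
  p μ n v hv := by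
    rcases n with (_ | n) | n
    · exact neg_mem (mem_ker_of_commute (onFn_onBos _ _).symm hv)
    · exact neg_mem (bAnn_mem_ker _ hv)
    · exact bCre_mem_ker (by simp) hv
  psi μ n v hv := by
    rcases n with n | n
    · exact Submodule.smul_mem _ _ (mem_ker_of_commute (onBos_onFer _ _) hv)
    · exact mem_ker_of_commute (onBos_onFer _ _) hv
  j x n v hv := mem_ker_of_commute (onBos_onCur _ _) hv

/-! ### Evaluation of normal ordered products -/

/-- Meant for the products in `Q` whose second factor has a nonzero mode `n + 1`: with `n = 0` the
term `m = -2` is the one that survives in the end. -/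
theorem nopSign_eq_three (s : ℂ) {n : ℤ} {v : State 𝔤 d}
    (h₁ : ∀ m < -2, Φ m (Ψ (n - m - 1) v) = 0) (h₂ : ∀ m > 0, Ψ (n - m - 1) (Φ m v) = 0) :
    nopSign s Φ Ψ n v =
      Φ (-2) (Ψ (n + 1) v) + Φ (-1) (Ψ n v) + s • Ψ (n - 1) (Φ 0 v) := by
  rw [nopSign, finsum_eq_sum_of_support_subset (s := {-2, -1, 0})]
  · rw [Finset.sum_insert (by decide), Finset.sum_insert (by decide), Finset.sum_singleton]
    rw [if_pos (by decide), if_pos (by decide), if_neg (by decide),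
      show n - -2 - 1 = n + 1 by ring, show n - -1 - 1 = n by ring, sub_zero, add_assoc]
  · intro m hm
    rw [Function.mem_support] at hm
    by_contra hmem
    simp only [Finset.coe_insert, Finset.coe_singleton, Set.mem_insert_iff,
      Set.mem_singleton_iff, not_or] at hmem
    refine hm ?_
    split_ifs with h
    · exact h₁ m (by omega)
    · rw [h₂ m (by omega), smul_zero]

/-- If `Ψ_(k) v = 0` for `k > n` and `Φ_(m) v = 0` for `m > 0`, two terms are left. -/
theorem nopSign_eq (s : ℂ) {n : ℤ} {v : State 𝔤 d} (hΦ₀ : Stable ⊥ Φ) (hΨ₀ : Stable ⊥ Ψ)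
    (hΨ : ∀ k > n, Ψ k v = 0) (hΦ : ∀ m > 0, Φ m v = 0) :
    nopSign s Φ Ψ n v = Φ (-1) (Ψ n v) + s • Ψ (n - 1) (Φ 0 v) := by
  rw [nopSign_eq_three, hΨ (n + 1) (by omega), hΦ₀.map_zero, zero_add]
  · intro m hm
    rw [hΨ _ (by omega), hΦ₀.map_zero]
  · intro m hm
    rw [hΦ m hm, hΨ₀.map_zero]

theorem del_apply (Φ : WField 𝔤 d) (n : ℤ) (v : State 𝔤 d) :
    del Φ n v = (-(n : ℂ)) • Φ (n - 1) v := rfl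

/-! ### States without excited modes of `X` -/

/-- The states without excitations of `Π`. -/
def noPi (𝔤 : Type*) [LieRing 𝔤] [LieAlgebra ℝ 𝔤] (d : ℕ) : Submodule ℂ (State 𝔤 d) :=
  ⨅ (μ : Fin d) (k : ℕ), LinearMap.ker (bAnn (.p μ k))

theorem mem_noPi {v : State 𝔤 d} : v ∈ noPi 𝔤 d ↔ ∀ μ k, bAnn (.p μ k) v = 0 := by
  simp [noPi]

theorem stable_noPi_fX (μ : Fin d) : Stable (noPi 𝔤 d) (fX μ) := by
  intro n v hv
  rw [mem_noPi] at hv ⊢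
  intro ν k
  rcases n with n | (_ | n)
  · exact bAnn_mem_ker _ (hv ν k)
  · exact mem_ker_of_commute (onFn_onBos _ _).symm (hv ν k)
  · exact bCre_mem_ker (by simp) (hv ν k)

theorem fX_of_nonneg {μ : Fin d} {n : ℤ} (hn : 0 ≤ n) {v : State 𝔤 d} (hv : v ∈ noPi 𝔤 d) :
    fX μ n v = 0 := by
  lift n to ℕ using hn
  exact mem_noPi.mp hv μ n

theorem foldr_fX_mem {v : State 𝔤 d} (hv : v ∈ noPi 𝔤 d) (l : List (Fin d × ℤ)) :
    l.foldr (fun q w => fX q.1 q.2 w) v ∈ noPi 𝔤 d := by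
  induction l with
  | nil => exact hv
  | cons q l ih => exact stable_noPi_fX _ _ _ ih

theorem foldr_fX_eq_zero {v : State 𝔤 d} (hv : v ∈ noPi 𝔤 d) {l : List (Fin d × ℤ)}
    (h : ∃ q ∈ l, 0 ≤ q.2) : l.foldr (fun q w => fX q.1 q.2 w) v = 0 := by
  induction l with
  | nil => simp at h
  | cons q l ih =>
    rw [List.foldr_cons]
    by_cases hq : 0 ≤ q.2
    · exact fX_of_nonneg hq (foldr_fX_mem hv l)
    · obtain ⟨r, hr, h0⟩ := h
      rcases List.mem_cons.mp hr with rfl | hr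
      · exact absurd h0 hq
      · rw [ih ⟨r, hr, h0⟩]
        exact (ghostStable_bot.x _).map_zero _

theorem length_le_sum {l : List (Fin d × ℤ)} (h : ∀ q ∈ l, q.2 ≤ -2) :
    (l.length : ℤ) ≤ (l.map fun q => -q.2 - 1).sum := by
  induction l with
  | nil => simp
  | cons q l ih =>
    have := h q (by simp)
    have := ih fun r hr => h r (by simp [hr])
    simp only [List.length_cons, List.map_cons, List.sum_cons]
    push_cast
    omega

/-- A factor `X_(k)` with `k ≤ -2` adds at least 1 to the sum, so a sum below the length forces an
annihilating mode. On states without `Π` excitations the modes `n ≥ -1` of `f(X)` thus retain only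
the constant Taylor term, which sits in the mode -1. -/
theorem exists_nonneg_of_sum_le {l : List (Fin d × ℤ)} (hne : ∀ q ∈ l, q.2 ≠ -1)
    (hl : (l.map fun q => -q.2 - 1).sum < (l.length : ℤ)) : ∃ q ∈ l, 0 ≤ q.2 := by
  by_contra! h
  have := length_le_sum (l := l) fun q hq => by have := h q hq; have := hne q hq; omega
  omega

theorem fFn_of_nonneg (f : SmoothFn d) {n : ℤ} (hn : 0 ≤ n) {v : State 𝔤 d}
    (hv : v ∈ noPi 𝔤 d) : fFn f n v = 0 := by
  refine finsum_eq_zero_of_forall_eq_zero fun l => ?_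
  split_ifs with h
  · rw [foldr_fX_eq_zero hv (exists_nonneg_of_sum_le h.1 (by omega)), map_zero, smul_zero]
  · rfl

theorem fFn_neg_one (f : SmoothFn d) {v : State 𝔤 d} (hv : v ∈ noPi 𝔤 d) :
    fFn f (-1) v = mulFn f v := by
  rw [fFn, finsum_eq_single _ []]
  · simp
  · intro l hl
    have := List.length_pos_iff.mpr hl
    split_ifs with h
    · rw [foldr_fX_eq_zero hv (exists_nonneg_of_sum_le h.1 (by omega)), map_zero, smul_zero]
    · rfl

end Fields

/-! ### Normal ordered constituents of the currents on nearly vacuum states. -/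

section Quiet

variable {𝔤 : Type*} [LieRing 𝔤] [LieAlgebra ℝ 𝔤] {d : ℕ} {v : State 𝔤 d} {n : ℤ}

/-! ### States annihilated by the positive modes -/

/-- The states without bosonic excitations that are annihilated by the modes `j_(n)`, `n ≥ 1`. -/
def quiet (𝔤 : Type*) [LieRing 𝔤] [LieAlgebra ℝ 𝔤] (d : ℕ) : Submodule ℂ (State 𝔤 d) :=
  (⨅ i, LinearMap.ker (bAnn i)) ⊓ ⨅ (x : 𝔤) (n : ℕ), LinearMap.ker (opJ x (n + 1))

theorem mem_quiet : v ∈ quiet 𝔤 d ↔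
    (∀ i, bAnn i v = 0) ∧ ∀ (x : 𝔤) (n : ℕ), opJ x (n + 1) v = 0 := by
  simp [quiet]

theorem quiet_le_noPi : quiet 𝔤 d ≤ noPi 𝔤 d :=
  fun _ hv => mem_noPi.mpr fun _ _ => (mem_quiet.mp hv).1 _

theorem onFn_mem_quiet (T : Module.End ℂ (SmoothFn d)) (hv : v ∈ quiet 𝔤 d) :
    onFn T v ∈ quiet 𝔤 d :=
  mem_quiet.mpr ⟨fun i => mem_ker_of_commute (onFn_onBos _ _).symm ((mem_quiet.mp hv).1 i),
    fun x n => mem_ker_of_commute (onFn_onCur _ _).symm ((mem_quiet.mp hv).2 x n)⟩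

theorem onFer_mem_quiet (T : Module.End ℂ (Fer d)) (hv : v ∈ quiet 𝔤 d) :
    onFer T v ∈ quiet 𝔤 d :=
  mem_quiet.mpr ⟨fun i => mem_ker_of_commute (onBos_onFer _ _) ((mem_quiet.mp hv).1 i),
    fun x n => mem_ker_of_commute (onFer_onCur _ _).symm ((mem_quiet.mp hv).2 x n)⟩

/-- The commutator of `j_(n)` with `j_(0)` is again a mode `n`, so zero modes of currents stay in
the subspace. -/
theorem opJ_zero_mem_quiet (x : 𝔤) (hv : v ∈ quiet 𝔤 d) : opJ x 0 v ∈ quiet 𝔤 d := by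
  obtain ⟨h₁, h₂⟩ := mem_quiet.mp hv
  refine mem_quiet.mpr ⟨fun i => mem_ker_of_commute (onBos_onCur _ _) (h₁ i), fun y n => ?_⟩
  rw [opJ_opJ, h₂, map_zero, add_zero, h₂, zero_add]

theorem fPsi_mem_quiet (μ : Fin d) (n : ℤ) (hv : v ∈ quiet 𝔤 d) : fPsi μ n v ∈ quiet 𝔤 d := by
  rcases n with n | n
  · exact Submodule.smul_mem _ _ (onFer_mem_quiet _ hv)
  · exact onFer_mem_quiet _ hv

theorem fPi_zero_mem_quiet (μ : Fin d) (hv : v ∈ quiet 𝔤 d) : fPi μ 0 v ∈ quiet 𝔤 d :=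
  neg_mem (onFn_mem_quiet _ hv)

theorem fJ_of_pos (hv : v ∈ quiet 𝔤 d) (x : 𝔤) (hn : 0 < n) : fJ x n v = 0 := by
  obtain ⟨k, rfl⟩ : ∃ k : ℕ, n = k + 1 := ⟨(n - 1).toNat, by omega⟩
  exact (mem_quiet.mp hv).2 x k

theorem fPi_of_pos (hv : v ∈ quiet 𝔤 d) (μ : Fin d) (hn : 0 < n) : fPi μ n v = 0 := by
  obtain ⟨k, rfl⟩ : ∃ k : ℕ, n = Int.ofNat (k + 1) := ⟨(n - 1).toNat, by
    rw [Int.ofNat_eq_natCast]; omega⟩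
  change -(bAnn _ v) = 0
  rw [(mem_quiet.mp hv).1, neg_zero]

theorem fGamma_of_neg_one_le (hv : ∀ i, bAnn i v = 0) (hn : -1 ≤ n) : fGamma n v = 0 := by
  rcases n with n | (_ | n)
  · exact hv _
  · exact hv _
  · omega

theorem fBeta_of_pos (hv : v ∈ quiet 𝔤 d) (hn : 0 < n) : fBeta n v = 0 := by
  obtain ⟨k, rfl⟩ : ∃ k : ℕ, n = Int.ofNat (k + 1) := ⟨(n - 1).toNat, by
    rw [Int.ofNat_eq_natCast]; omega⟩
  change -(bAnn _ v) = 0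
  rw [(mem_quiet.mp hv).1, neg_zero]

/-! ### The constituents of the currents on quiet states -/

section Constituents

variable (hv : v ∈ quiet 𝔤 d)

include hv

theorem fFn_quiet (f : SmoothFn d) (hn : 0 ≤ n) : fFn f n v = 0 :=
  fFn_of_nonneg f hn (quiet_le_noPi hv)

theorem del_fFn_quiet (f : SmoothFn d) (hn : 0 ≤ n) : del (fFn f) n v = 0 := by
  rcases hn.eq_or_lt with rfl | hn
  · simp [del_apply]
  · rw [del_apply, fFn_quiet hv f (by omega), smul_zero]

theorem fn_j_of_pos (f : SmoothFn d) (x : 𝔤) (hn : 0 < n) : nop (fFn f) (fJ x) n v = 0 := by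
  rw [nop, nopSign_eq _ (ghostStable_bot.fn f) (ghostStable_bot.j x)
    (fun k hk => fJ_of_pos hv x (by omega)) (fun m hm => fFn_quiet hv f hm.le),
    fJ_of_pos hv x hn, (ghostStable_bot.fn f).map_zero, fFn_quiet hv f le_rfl,
    (ghostStable_bot.j x).map_zero, smul_zero, add_zero]

theorem fn_j_zero (f : SmoothFn d) (x : 𝔤) :
    nop (fFn f) (fJ x) 0 v = mulFn f (opJ x 0 v) := by
  rw [nop, nopSign_eq _ (ghostStable_bot.fn f) (ghostStable_bot.j x)
    (fun k hk => fJ_of_pos hv x hk) (fun m hm => fFn_quiet hv f hm.le),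
    fFn_quiet hv f le_rfl, (ghostStable_bot.j x).map_zero, smul_zero, add_zero, fJ_eq,
    fFn_neg_one f (quiet_le_noPi (opJ_zero_mem_quiet x hv))]

theorem p_p_one (μ : Fin d) :
    nop (fPi μ) (fPi μ) 1 v = onFn (pd μ) (onFn (pd μ) v) := by
  rw [nop, nopSign_eq _ (ghostStable_bot.p μ) (ghostStable_bot.p μ)
    (fun k hk => fPi_of_pos hv μ (by omega)) (fun m hm => fPi_of_pos hv μ hm),
    fPi_of_pos hv μ (by omega), (ghostStable_bot.p μ).map_zero, zero_add, one_smul, sub_self]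
  change -(onFn _ (-(onFn _ v))) = _
  rw [map_neg, neg_neg]

theorem p_p_of_two_le (μ : Fin d) (hn : 2 ≤ n) : nop (fPi μ) (fPi μ) n v = 0 := by
  rw [nop, nopSign_eq _ (ghostStable_bot.p μ) (ghostStable_bot.p μ)
    (fun k hk => fPi_of_pos hv μ (by omega)) (fun m hm => fPi_of_pos hv μ hm),
    fPi_of_pos hv μ (by omega), (ghostStable_bot.p μ).map_zero, zero_add, one_smul,
    fPi_of_pos (fPi_zero_mem_quiet μ hv) μ (by omega)]

/-- Normal ordering puts `Π_(0) = -∂` to the right of `A`, so the derivative does not act on `A`.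
The missing `∂A` term comes from the total derivative in `H`. -/
theorem p_fn_j_one (μ : Fin d) (f : SmoothFn d) (x : 𝔤) :
    nop (fPi μ) (nop (fFn f) (fJ x)) 1 v = -mulFn f (opJ x 0 (onFn (pd μ) v)) := by
  rw [nop, nopSign_eq _ (ghostStable_bot.p μ) ((ghostStable_bot.fn f).nop (ghostStable_bot.j x))
    (fun k hk => fn_j_of_pos hv f x (by omega)) (fun m hm => fPi_of_pos hv μ hm),
    fn_j_of_pos hv f x one_pos, (ghostStable_bot.p μ).map_zero, zero_add, one_smul, sub_self,
    fn_j_zero (fPi_zero_mem_quiet μ hv)]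
  change mulFn f (opJ x 0 (-(onFn _ v))) = _
  rw [map_neg, map_neg]

theorem p_fn_j_of_two_le (μ : Fin d) (f : SmoothFn d) (x : 𝔤) (hn : 2 ≤ n) :
    nop (fPi μ) (nop (fFn f) (fJ x)) n v = 0 := by
  rw [nop, nopSign_eq _ (ghostStable_bot.p μ) ((ghostStable_bot.fn f).nop (ghostStable_bot.j x))
    (fun k hk => fn_j_of_pos hv f x (by omega)) (fun m hm => fPi_of_pos hv μ hm),
    fn_j_of_pos hv f x (by omega), (ghostStable_bot.p μ).map_zero, zero_add, one_smul,
    fn_j_of_pos (fPi_zero_mem_quiet μ hv) f x (by omega)]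

theorem j_j_one (x y : 𝔤) : nop (fJ x) (fJ y) 1 v = opJ y 0 (opJ x 0 v) := by
  rw [nop, nopSign_eq _ (ghostStable_bot.j x) (ghostStable_bot.j y)
    (fun k hk => fJ_of_pos hv y (by omega)) (fun m hm => fJ_of_pos hv x hm),
    fJ_of_pos hv y one_pos, (ghostStable_bot.j x).map_zero, zero_add, one_smul, sub_self,
    fJ_eq, fJ_eq]

theorem j_j_of_two_le (x y : 𝔤) (hn : 2 ≤ n) : nop (fJ x) (fJ y) n v = 0 := by
  rw [nop, nopSign_eq _ (ghostStable_bot.j x) (ghostStable_bot.j y)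
    (fun k hk => fJ_of_pos hv y (by omega)) (fun m hm => fJ_of_pos hv x hm),
    fJ_of_pos hv y (by omega), (ghostStable_bot.j x).map_zero, zero_add, one_smul, fJ_eq v x,
    fJ_of_pos (opJ_zero_mem_quiet x hv) y (by omega)]

theorem fn_j_j_one (f : SmoothFn d) (x y : 𝔤) :
    nop (fFn f) (nop (fJ x) (fJ y)) 1 v = mulFn f (opJ y 0 (opJ x 0 v)) := by
  have hj := (ghostStable_bot (d := d)).j x |>.nop (ghostStable_bot.j y)
  rw [nop, nopSign_eq _ (ghostStable_bot.fn f) hj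
    (fun k hk => j_j_of_two_le hv x y (by omega)) (fun m hm => fFn_quiet hv f hm.le),
    fFn_quiet hv f le_rfl, hj.map_zero, smul_zero, add_zero, j_j_one hv,
    fFn_neg_one f (quiet_le_noPi (opJ_zero_mem_quiet y (opJ_zero_mem_quiet x hv)))]

theorem fn_j_j_of_two_le (f : SmoothFn d) (x y : 𝔤) (hn : 2 ≤ n) :
    nop (fFn f) (nop (fJ x) (fJ y)) n v = 0 := by
  have hj := (ghostStable_bot (d := d)).j x |>.nop (ghostStable_bot.j y)
  rw [nop, nopSign_eq _ (ghostStable_bot.fn f) hj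
    (fun k hk => j_j_of_two_le hv x y (by omega)) (fun m hm => fFn_quiet hv f hm.le),
    fFn_quiet hv f le_rfl, hj.map_zero, smul_zero, add_zero, j_j_of_two_le hv x y hn,
    (ghostStable_bot.fn f).map_zero]

theorem fn_del_fn (f g : SmoothFn d) (hn : 0 ≤ n) : nop (fFn f) (del (fFn g)) n v = 0 := by
  have hg := (ghostStable_bot (𝔤 := 𝔤)).fn g |>.del
  rw [nop, nopSign_eq _ (ghostStable_bot.fn f) hg
    (fun k hk => del_fFn_quiet hv g (by omega)) (fun m hm => fFn_quiet hv f hm.le),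
    fFn_quiet hv f le_rfl, hg.map_zero, smul_zero, add_zero, del_fFn_quiet hv g hn,
    (ghostStable_bot.fn f).map_zero]

/-- The nonnegative modes of `∂(f(X))` vanish on these states, so the correction `f^{abc} j^c A^b
∂A^a` in `H` does not contribute to `H_(1) V`. -/
theorem j_fn_del_fn (x : 𝔤) (f g : SmoothFn d) (hn : 0 < n) :
    nop (fJ x) (nop (fFn f) (del (fFn g))) n v = 0 := by
  have hg := (ghostStable_bot (𝔤 := 𝔤)).fn f |>.nop (ghostStable_bot.fn g).del
  rw [nop, nopSign_eq _ (ghostStable_bot.j x) hg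
    (fun k hk => fn_del_fn hv f g (by omega)) (fun m hm => fJ_of_pos hv x hm),
    fn_del_fn hv f g hn.le, (ghostStable_bot.j x).map_zero, zero_add, one_smul,
    fJ_eq, fn_del_fn (opJ_zero_mem_quiet x hv) f g (by omega)]

theorem p_del_x (μ : Fin d) (hn : 0 < n) : nop (fPi μ) (del (fX μ)) n v = 0 := by
  have hd {w : State 𝔤 d} (hw : w ∈ quiet 𝔤 d) {k : ℤ} (hk : 0 ≤ k) : del (fX μ) k w = 0 := by
    rcases hk.eq_or_lt with rfl | hk
    · simp [del_apply]
    · rw [del_apply, fX_of_nonneg (by omega) (quiet_le_noPi hw), smul_zero]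
  rw [nop, nopSign_eq _ (ghostStable_bot.p μ) (ghostStable_bot.x μ).del
    (fun k hk => hd hv (by omega)) (fun m hm => fPi_of_pos hv μ hm),
    hd hv hn.le, (ghostStable_bot.p μ).map_zero, hd (fPi_zero_mem_quiet μ hv) (by omega),
    smul_zero, add_zero]

theorem beta_del_gamma (hn : 0 < n) : nop fBeta (del fGamma) n v = 0 := by
  have hb := (mem_quiet.mp hv).1
  rw [nop, nopSign_eq _ ghostStable_bot.beta ghostStable_bot.gamma.del
    (fun k hk => by rw [del_apply, fGamma_of_neg_one_le hb (by omega), smul_zero])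
    (fun m hm => fBeta_of_pos hv hm), del_apply, fGamma_of_neg_one_le hb (by omega), smul_zero,
    ghostStable_bot.beta.map_zero, zero_add, one_smul, del_apply]
  obtain ⟨k, rfl⟩ : ∃ k : ℕ, n = k + 1 := ⟨(n - 1).toNat, by omega⟩
  rcases k with _ | k
  -- For `n = 1` the zero mode of `∂γ` appears, and its prefactor is 0.
  · simp
  · rw [show ((k + 1 : ℕ) + 1 - 1 - 1 : ℤ) = Int.ofNat k by rw [Int.ofNat_eq_natCast]; omega]
    change _ • bAnn (.β (k + 1)) (bCre (.β 0) v) = 0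
    rw [bAnn_bCre_of_ne _ (by simp), hb, map_zero, smul_zero]

/-- `(∂β)_(1) = -β_(0)`, and in this picture `β_(0)` creates while `γ_(-1)` removes what it created.
With the coefficient -1/2 in `T` this yields the weight 1/2 of `δ(γ)`. -/
theorem gamma_del_beta_one : nop fGamma (del fBeta) 1 v = -v := by
  have hb := (mem_quiet.mp hv).1
  rw [nop, nopSign_eq _ ghostStable_bot.gamma ghostStable_bot.beta.del
    (fun k hk => by rw [del_apply, fBeta_of_pos hv (by omega), smul_zero])
    (fun m hm => fGamma_of_neg_one_le hb (by omega)), fGamma_of_neg_one_le hb (by omega),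
    ghostStable_bot.beta.del.map_zero, smul_zero, add_zero, del_apply]
  change bAnn (.β 0) ((-((1 : ℤ) : ℂ)) • bCre (.β 0) v) = -v
  rw [map_smul, bAnn_bCre_self, hb, map_zero, add_zero, Int.cast_one, neg_smul, one_smul]

theorem gamma_del_beta_of_two_le (hn : 2 ≤ n) : nop fGamma (del fBeta) n v = 0 := by
  have hb := (mem_quiet.mp hv).1
  rw [nop, nopSign_eq _ ghostStable_bot.gamma ghostStable_bot.beta.del
    (fun k hk => by rw [del_apply, fBeta_of_pos hv (by omega), smul_zero])
    (fun m hm => fGamma_of_neg_one_le hb (by omega)), fGamma_of_neg_one_le hb (by omega),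
    ghostStable_bot.beta.del.map_zero, smul_zero, add_zero, del_apply,
    fBeta_of_pos hv (by omega), smul_zero, ghostStable_bot.gamma.map_zero]

end Constituents

theorem gamma_gamma (hb : ∀ i, bAnn i v = 0) (hn : -1 ≤ n) : nop fGamma fGamma n v = 0 := by
  refine finsum_eq_zero_of_forall_eq_zero fun m => ?_
  -- Either `l ≥ -1` and `γ_(l)` kills `v`, or `l ≤ -2`. Then `k ≥ 0`, and `γ_(k)` commutes past the
  -- creation mode `γ_(l)` to kill `v`.
  have key {k l : ℤ} (h : -2 ≤ k + l) : fGamma k (fGamma l v) = 0 := by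
    by_cases hl : -1 ≤ l
    · rw [fGamma_of_neg_one_le hb hl, ghostStable_bot.gamma.map_zero]
    · obtain ⟨l, rfl⟩ : ∃ l' : ℕ, l = Int.negSucc (l' + 1) := ⟨(-l - 2).toNat, by
        rw [Int.negSucc_eq]; omega⟩
      obtain ⟨k, rfl⟩ : ∃ k' : ℕ, k = Int.ofNat k' := ⟨k.toNat, by
        rw [Int.negSucc_eq] at h; rw [Int.ofNat_eq_natCast]; omega⟩
      change bAnn _ (bCre _ v) = 0
      rw [bAnn_bCre_of_ne _ (by simp), hb, map_zero]
  split_ifs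
  · exact key (by omega)
  · rw [key (by omega), smul_zero]

/-! ### The fermionic constituents -/

/-- At most one excitation of `ψ`, and it is of the lowest mode. -/
structure PsiQuiet (v : State 𝔤 d) : Prop where
  high : ∀ μ k, fAnn (.ψ μ (k + 1)) v = 0
  two : ∀ μ ν, fAnn (.ψ μ 0) (fAnn (.ψ ν 0) v) = 0

namespace PsiQuiet

variable (hp : PsiQuiet v)

include hp

theorem of_pos (μ : Fin d) (hn : 0 < n) : fPsi μ n v = 0 := by
  obtain ⟨k, rfl⟩ : ∃ k : ℕ, n = Int.ofNat (k + 1) := ⟨(n - 1).toNat, by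
    rw [Int.ofNat_eq_natCast]; omega⟩
  change eta μ • (fAnn _ v) = 0
  rw [hp.high, smul_zero]

theorem of_nonneg_zero (μ ν : Fin d) (hn : 0 ≤ n) : fPsi μ n (fPsi ν 0 v) = 0 := by
  lift n to ℕ using hn
  change eta μ • fAnn (.ψ μ n) (eta ν • fAnn (.ψ ν 0) v) = 0
  rcases n with _ | n
  · rw [map_smul, hp.two, smul_zero, smul_zero]
  · rw [map_smul, fAnn_fAnn, hp.high, map_zero, neg_zero, smul_zero, smul_zero]

/-- This is the Lorentz rotation of the vector index carried by the single `ψ`; paired with `F` it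
gives the spin coupling. -/
theorem psi_psi_zero (μ ν : Fin d) : nopF (fPsi μ) (fPsi ν) 0 v =
    fPsi μ (-1) (fPsi ν 0 v) - fPsi ν (-1) (fPsi μ 0 v) := by
  rw [nopF, nopSign_eq _ (ghostStable_bot.psi μ) (ghostStable_bot.psi ν)
    (fun k hk => hp.of_pos ν hk) (fun m hm => hp.of_pos μ hm), neg_one_smul, ← sub_eq_add_neg,
    zero_sub]

theorem psi_psi_of_pos (μ ν : Fin d) (hn : 0 < n) : nopF (fPsi μ) (fPsi ν) n v = 0 := by
  rw [nopF, nopSign_eq _ (ghostStable_bot.psi μ) (ghostStable_bot.psi ν)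
    (fun k hk => hp.of_pos ν (by omega)) (fun m hm => hp.of_pos μ hm), hp.of_pos ν hn,
    (ghostStable_bot.psi μ).map_zero, hp.of_nonneg_zero ν μ (by omega), smul_zero, add_zero]

theorem psi_del_psi_one (μ : Fin d) :
    nopF (fPsi μ) (del (fPsi μ)) 1 v = -fPsi μ (-1) (fPsi μ 0 v) := by
  rw [nopF, nopSign_eq _ (ghostStable_bot.psi μ) (ghostStable_bot.psi μ).del
    (fun k hk => by rw [del_apply, hp.of_pos μ (by omega), smul_zero])
    (fun m hm => hp.of_pos μ hm), del_apply, del_apply]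
  -- The exchanged term contains the zero mode of a derivative, so its prefactor is 0.
  change fCre _ _ + _ = -fCre _ _
  rw [map_smul]
  simp

theorem psi_del_psi_of_two_le (μ : Fin d) (hn : 2 ≤ n) :
    nopF (fPsi μ) (del (fPsi μ)) n v = 0 := by
  rw [nopF, nopSign_eq _ (ghostStable_bot.psi μ) (ghostStable_bot.psi μ).del
    (fun k hk => by rw [del_apply, hp.of_pos μ (by omega), smul_zero])
    (fun m hm => hp.of_pos μ hm), del_apply, del_apply, hp.of_pos μ (by omega), smul_zero,
    (ghostStable_bot.psi μ).map_zero, hp.of_nonneg_zero μ μ (by omega), smul_zero, smul_zero,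
    add_zero]

variable (hv : v ∈ quiet 𝔤 d)

include hv

theorem psi_psi_zero_mem_quiet (μ ν : Fin d) : nopF (fPsi μ) (fPsi ν) 0 v ∈ quiet 𝔤 d := by
  rw [hp.psi_psi_zero]
  exact sub_mem (fPsi_mem_quiet _ _ (fPsi_mem_quiet _ _ hv))
    (fPsi_mem_quiet _ _ (fPsi_mem_quiet _ _ hv))

theorem psi_psi_fn_j_one (μ ν : Fin d) (f : SmoothFn d) (x : 𝔤) :
    nop (nopF (fPsi μ) (fPsi ν)) (nop (fFn f) (fJ x)) 1 v =
      mulFn f (opJ x 0 (fPsi μ (-1) (fPsi ν 0 v) - fPsi ν (-1) (fPsi μ 0 v))) := by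
  have hs := (ghostStable_bot (𝔤 := 𝔤)).psi μ |>.nopF (ghostStable_bot.psi ν)
  rw [nop, nopSign_eq _ hs ((ghostStable_bot.fn f).nop (ghostStable_bot.j x))
    (fun k hk => fn_j_of_pos hv f x (by omega)) (fun m hm => hp.psi_psi_of_pos μ ν hm),
    fn_j_of_pos hv f x one_pos, hs.map_zero, zero_add, one_smul, sub_self,
    fn_j_zero (hp.psi_psi_zero_mem_quiet hv μ ν), hp.psi_psi_zero]

theorem psi_psi_fn_j_of_two_le (μ ν : Fin d) (f : SmoothFn d) (x : 𝔤) (hn : 2 ≤ n) :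
    nop (nopF (fPsi μ) (fPsi ν)) (nop (fFn f) (fJ x)) n v = 0 := by
  have hs := (ghostStable_bot (𝔤 := 𝔤)).psi μ |>.nopF (ghostStable_bot.psi ν)
  rw [nop, nopSign_eq _ hs ((ghostStable_bot.fn f).nop (ghostStable_bot.j x))
    (fun k hk => fn_j_of_pos hv f x (by omega)) (fun m hm => hp.psi_psi_of_pos μ ν hm),
    fn_j_of_pos hv f x (by omega), hs.map_zero, zero_add, one_smul,
    fn_j_of_pos (hp.psi_psi_zero_mem_quiet hv μ ν) f x (by omega)]

end PsiQuiet

end Quiet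

/-! ### The modes `n ≥ 1` of `G`, `H` and `T`. -/

section Evaluation

variable {𝔤 ι : Type*} [LieRing 𝔤] [LieAlgebra ℝ 𝔤] [Fintype ι] (e : Module.Basis ι ℝ 𝔤) {d : ℕ}
  {v : State 𝔤 d} {n : ℤ}

/-! ### The currents on states with at most one lowest excitation of each kind -/

theorem p_sub_fn_j_of_pos (hv : v ∈ quiet 𝔤 d) (A : Fin d → ι → SmoothFn d) (μ : Fin d)
    (hn : 0 < n) : (fPi μ - ∑ a, nop (fFn (A μ a)) (fJ (e a)) : WField 𝔤 d) n v = 0 := by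
  simp only [Pi.sub_apply, Finset.sum_apply, fPi_of_pos hv μ hn, fn_j_of_pos hv _ _ hn,
    Finset.sum_const_zero, sub_zero]

theorem p_sub_fn_j_zero (hv : v ∈ quiet 𝔤 d) (A : Fin d → ι → SmoothFn d) (μ : Fin d) :
    (fPi μ - ∑ a, nop (fFn (A μ a)) (fJ (e a)) : WField 𝔤 d) 0 v =
      -(onFn (pd μ) v + ∑ a, mulFn (A μ a) (opJ (e a) 0 v)) := by
  simp only [Pi.sub_apply, Finset.sum_apply, fn_j_zero hv]
  rw [neg_add, ← sub_eq_add_neg]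
  rfl

theorem curG_one (hv : v ∈ quiet 𝔤 d) (hp : PsiQuiet v) (A : Fin d → ι → SmoothFn d) :
    curG e A 1 v =
      -∑ μ, (onFn (pd μ) (fPsi μ 0 v) + ∑ a, mulFn (A μ a) (opJ (e a) 0 (fPsi μ 0 v))) := by
  have h (μ : Fin d) : Stable ⊥ (fPi μ - ∑ a, nop (fFn (A μ a)) (fJ (e a))) :=
    (ghostStable_bot.p μ).sub (.sum fun _ => (ghostStable_bot.fn _).nop (ghostStable_bot.j _))
  simp only [curG, Finset.sum_apply, ← Finset.sum_neg_distrib]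
  refine Finset.sum_congr rfl fun μ _ => ?_
  rw [nop, nopSign_eq _ (ghostStable_bot.psi μ) (h μ)
    (fun k hk => p_sub_fn_j_of_pos e hv A μ (by omega)) (fun m hm => hp.of_pos μ hm),
    p_sub_fn_j_of_pos e hv A μ one_pos, (ghostStable_bot.psi μ).map_zero, zero_add, one_smul,
    sub_self, p_sub_fn_j_zero e (fPsi_mem_quiet μ 0 hv)]

theorem curG_of_two_le (hv : v ∈ quiet 𝔤 d) (hp : PsiQuiet v) (A : Fin d → ι → SmoothFn d)
    (hn : 2 ≤ n) : curG e A n v = 0 := by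
  have h (μ : Fin d) : Stable ⊥ (fPi μ - ∑ a, nop (fFn (A μ a)) (fJ (e a))) :=
    (ghostStable_bot.p μ).sub (.sum fun _ => (ghostStable_bot.fn _).nop (ghostStable_bot.j _))
  simp only [curG, Finset.sum_apply]
  refine Finset.sum_eq_zero fun μ _ => ?_
  rw [nop, nopSign_eq _ (ghostStable_bot.psi μ) (h μ)
    (fun k hk => p_sub_fn_j_of_pos e hv A μ (by omega)) (fun m hm => hp.of_pos μ hm),
    p_sub_fn_j_of_pos e hv A μ (by omega), (ghostStable_bot.psi μ).map_zero, zero_add, one_smul,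
    p_sub_fn_j_of_pos e (fPsi_mem_quiet μ 0 hv) A μ (by omega)]

/-- The last term of the first sum comes from `-∂(∂_μ A^μ j)`, because mode 1 of `∂Φ` is `-Φ_(0)`.
It completes the other three to a covariant square, see `covOp_covOp`. -/
theorem curH_one (hv : v ∈ quiet 𝔤 d) (hp : PsiQuiet v) (A : Fin d → ι → SmoothFn d) :
    curH e A 1 v =
      ∑ μ, eta μ • (onFn (pd μ) (onFn (pd μ) v)
        + (2 : ℂ) • ∑ a, mulFn (A μ a) (opJ (e a) 0 (onFn (pd μ) v))
        + ∑ a, ∑ b, mulFn (A μ a * A μ b) (opJ (e b) 0 (opJ (e a) 0 v))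
        + ∑ a, mulFn (pd μ (A μ a)) (opJ (e a) 0 v))
      + ∑ μ, ∑ ν, ∑ a, mulFn (fieldStrength e A μ ν a) (opJ (e a) 0
          (fPsi μ (-1) (fPsi ν 0 v) - fPsi ν (-1) (fPsi μ 0 v))) := by
  simp only [curH, Pi.add_apply, Pi.sub_apply, Pi.smul_apply, Finset.sum_apply, p_p_one hv,
    p_fn_j_one hv, fn_j_j_one hv, hp.psi_psi_fn_j_one hv, del_apply, sub_self, fn_j_zero hv,
    j_fn_del_fn hv _ _ _ one_pos, smul_zero, Finset.sum_const_zero, add_zero, smul_add,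
    Finset.sum_add_distrib, Finset.sum_neg_distrib, smul_neg, Int.cast_one, neg_smul, one_smul,
    sub_neg_eq_add, Finset.smul_sum, smul_comm (2 : ℂ)]
  abel

theorem curH_of_two_le (hv : v ∈ quiet 𝔤 d) (hp : PsiQuiet v) (A : Fin d → ι → SmoothFn d)
    (hn : 2 ≤ n) : curH e A n v = 0 := by
  simp only [curH, Pi.add_apply, Pi.sub_apply, Pi.smul_apply, Finset.sum_apply,
    p_p_of_two_le hv _ hn, p_fn_j_of_two_le hv _ _ _ hn, fn_j_j_of_two_le hv _ _ _ hn,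
    hp.psi_psi_fn_j_of_two_le hv _ _ _ _ hn, del_apply, fn_j_of_pos hv _ _ (show 0 < n - 1 by omega),
    j_fn_del_fn hv _ _ _ (show 0 < n by omega), smul_zero, Finset.sum_const_zero, add_zero, sub_zero]

/-- At most the lowest excitation of `c̄`, and no excitation of `b̄`; the lowest mode of `c̄` is
filled. -/
structure CbarFilled (v : State 𝔤 d) : Prop where
  bbar : ∀ k, fAnn (.bbar k) v = 0
  high : ∀ k, fAnn (.cbar (k + 1)) v = 0
  fill : fCre (.cbar 0) v = 0

namespace CbarFilled

variable (hc : CbarFilled v)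

include hc

theorem cbar_of_nonneg (hn : -1 ≤ n) : fCbar n v = 0 := by
  rcases n with n | (_ | n)
  · exact hc.bbar n
  · exact hc.fill
  · omega

theorem bbar_of_pos (hn : 0 < n) : fBbar n v = 0 := by
  obtain ⟨k, rfl⟩ : ∃ k : ℕ, n = Int.ofNat (k + 1) := ⟨(n - 1).toNat, by
    rw [Int.ofNat_eq_natCast]; omega⟩
  exact hc.high k

theorem cbar_of_nonneg_bbar (hn : 0 ≤ n) : fCbar n (fBbar 0 v) = 0 := by
  lift n to ℕ using hn
  change fAnn (.bbar n) (fAnn (.cbar 0) v) = 0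
  rw [fAnn_fAnn, hc.bbar, map_zero, neg_zero]

theorem cbar_del_bbar_one : nopF fCbar (del fBbar) 1 v = -v := by
  rw [nopF, nopSign_eq _ ghostStable_bot.cbar ghostStable_bot.bbar.del
    (fun k hk => by rw [del_apply, hc.bbar_of_pos (by omega), smul_zero])
    (fun m hm => hc.cbar_of_nonneg (by omega)), hc.cbar_of_nonneg (by omega),
    ghostStable_bot.bbar.del.map_zero, smul_zero, add_zero, del_apply]
  change fCre (.cbar 0) ((-((1 : ℤ) : ℂ)) • fAnn (.cbar 0) v) = -v
  -- The relation `b̄_(0) c̄_(-1) + c̄_(-1) b̄_(0) = 1` shows that a filled mode has occupation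
  -- number 1.
  have h : fCre (.cbar 0) (fAnn (.cbar 0) v) = v := by
    have := fAnn_fCre_self v (.cbar 0)
    rw [hc.fill, map_zero] at this
    exact (sub_eq_zero.mp this.symm).symm
  rw [map_smul, h, Int.cast_one, neg_smul, one_smul]

theorem cbar_del_bbar_of_two_le (hn : 2 ≤ n) : nopF fCbar (del fBbar) n v = 0 := by
  rw [nopF, nopSign_eq _ ghostStable_bot.cbar ghostStable_bot.bbar.del
    (fun k hk => by rw [del_apply, hc.bbar_of_pos (by omega), smul_zero])
    (fun m hm => hc.cbar_of_nonneg (by omega)), hc.cbar_of_nonneg (by omega),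
    ghostStable_bot.bbar.del.map_zero, smul_zero, add_zero, del_apply,
    hc.bbar_of_pos (by omega), smul_zero, ghostStable_bot.cbar.map_zero]

theorem bbar_del_cbar (hn : 0 < n) : nopF fBbar (del fCbar) n v = 0 := by
  rw [nopF, nopSign_eq _ ghostStable_bot.bbar ghostStable_bot.cbar.del
    (fun k hk => by rw [del_apply, hc.cbar_of_nonneg (by omega), smul_zero])
    (fun m hm => hc.bbar_of_pos hm), del_apply, hc.cbar_of_nonneg (by omega), smul_zero,
    ghostStable_bot.bbar.map_zero, zero_add, del_apply]
  obtain rfl | hn : n = 1 ∨ 2 ≤ n := by omega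
  · simp
  · rw [hc.cbar_of_nonneg_bbar (by omega), smul_zero, smul_zero]

end CbarFilled

/-- The final -1/2 is the weight -1 of `c̄` plus the weight 1/2 of `δ(γ)`. -/
theorem stressT_one (hv : v ∈ quiet 𝔤 d) (hp : PsiQuiet v) (hc : CbarFilled v) (C : ℝ) :
    stressT e C 1 v = (1 / 2 : ℂ) • (∑ μ, eta μ • fPsi μ (-1) (fPsi μ 0 v))
      - (C : ℂ)⁻¹ • (∑ a, opJ (e a) 0 (opJ (e a) 0 v)) - (1 / 2 : ℂ) • v := by
  simp only [stressT, Pi.add_apply, Pi.sub_apply, Pi.neg_apply, Pi.smul_apply, Finset.sum_apply,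
    p_del_x hv _ one_pos, hp.psi_del_psi_one, j_j_one hv, hc.cbar_del_bbar_one,
    hc.bbar_del_cbar one_pos, beta_del_gamma hv one_pos, gamma_del_beta_one hv,
    Finset.sum_const_zero, smul_zero, neg_zero, smul_neg, Finset.sum_neg_distrib]
  module

theorem stressT_of_two_le (hv : v ∈ quiet 𝔤 d) (hp : PsiQuiet v) (hc : CbarFilled v) (C : ℝ)
    (hn : 2 ≤ n) : stressT e C n v = 0 := by
  have hn' : 0 < n := by omega
  simp only [stressT, Pi.add_apply, Pi.sub_apply, Pi.neg_apply, Pi.smul_apply, Finset.sum_apply,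
    p_del_x hv _ hn', hp.psi_del_psi_of_two_le _ hn, j_j_of_two_le hv _ _ hn,
    hc.cbar_del_bbar_of_two_le hn, hc.bbar_del_cbar hn', beta_del_gamma hv hn',
    gamma_del_beta_of_two_le hv hn, Finset.sum_const_zero, smul_zero, neg_zero, sub_zero, add_zero]

end Evaluation

/-! ### Total antisymmetry and normalisation of the structure constants. -/

section StructureConstants

variable {𝔤 ι : Type*} [LieRing 𝔤] [LieAlgebra ℝ 𝔤]
  (e : Module.Basis ι ℝ 𝔤)

theorem structConst_antisymm (a b c : ι) : structConst e a b c = -structConst e b a c := by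
  rw [structConst, structConst, ← lie_skew, map_neg, Finsupp.neg_apply, Complex.ofReal_neg]

variable [Fintype ι] [DecidableEq ι]

theorem killingForm_basis_right {C : ℝ}
    (he : ∀ a b, killingForm ℝ 𝔤 (e a) (e b) = if a = b then -C else 0) (x : 𝔤) (c : ι) :
    killingForm ℝ 𝔤 x (e c) = -C * e.repr x c := by
  have h := congrArg (fun y => killingForm ℝ 𝔤 y (e c)) (e.sum_repr x)
  rw [← h]
  simp only [map_sum, map_smul, LinearMap.sum_apply, LinearMap.smul_apply, he, smul_eq_mul,
    mul_ite, mul_zero, Finset.sum_ite_eq', Finset.mem_univ, if_true]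
  ring

/-- Invariance of the Killing form, `κ([x,y],z) = κ(x,[y,z])`, in a basis where the form is a
nonzero multiple of the identity. -/
theorem structConst_cyclic {C : ℝ} (hC : C ≠ 0)
    (he : ∀ a b, killingForm ℝ 𝔤 (e a) (e b) = if a = b then -C else 0) (a b c : ι) :
    structConst e a b c = structConst e b c a := by
  have h := LieModule.traceForm_apply_lie_apply ℝ 𝔤 𝔤 (e a) (e b) (e c)
  change killingForm ℝ 𝔤 _ _ = killingForm ℝ 𝔤 _ _ at h
  rw [killingForm_basis_right e he, LieModule.traceForm_comm, show LieModule.traceForm ℝ 𝔤 𝔤 =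
    killingForm ℝ 𝔤 from rfl, killingForm_basis_right e he] at h
  rw [structConst, structConst, mul_left_cancel₀ (neg_ne_zero.mpr hC) h]

/-- The Killing form is the trace of `ad ∘ ad`; written out in the basis it is this sum, up to the
sign from antisymmetry in the last two indices. -/
theorem sum_structConst_mul {C : ℝ} (hC : C ≠ 0)
    (he : ∀ a b, killingForm ℝ 𝔤 (e a) (e b) = if a = b then -C else 0) (a b : ι) :
    ∑ c, ∑ k, structConst e a c k * structConst e b c k = if a = b then (C : ℂ) else 0 := by
  have h := he a b
  rw [killingForm_apply_apply, LinearMap.trace_eq_matrix_trace ℝ e, Matrix.trace] at h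
  simp only [LinearMap.toMatrix_comp e e e, Matrix.diag_apply, Matrix.mul_apply,
    LinearMap.toMatrix_apply, LieAlgebra.ad_apply] at h
  have h' := congrArg (fun r : ℝ => -(r : ℂ)) h
  simp only [Complex.ofReal_sum, Complex.ofReal_mul] at h'
  rw [show -((if a = b then -C else 0 : ℝ) : ℂ) = if a = b then (C : ℂ) else 0 by
    split_ifs <;> simp] at h'
  rw [← h', ← Finset.sum_neg_distrib]
  refine Finset.sum_congr rfl fun c _ => ?_
  rw [← Finset.sum_neg_distrib]
  refine Finset.sum_congr rfl fun k _ => ?_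
  change _ = -(structConst e a k c * structConst e b c k)
  rw [structConst_cyclic e hC he a k c, structConst_antisymm e k c a,
    ← structConst_cyclic e hC he a c k, neg_mul, neg_neg]

omit [DecidableEq ι] in
theorem opJ_lie {d : ℕ} (a b : ι) (n : ℤ) (v : State 𝔤 d) :
    opJ ⁅e a, e b⁆ n v = ∑ c, structConst e a b c • opJ (e c) n v := by
  conv_lhs => rw [← e.sum_repr ⁅e a, e b⁆, opJ_sum]
  rfl

end StructureConstants

/-! ### Adjoint multiplets of currents and the covariant derivative on states. -/

section Multiplets

variable {𝔤 ι : Type*} [LieRing 𝔤] [LieAlgebra ℝ 𝔤] [Fintype ι] (e : Module.Basis ι ℝ 𝔤) {d : ℕ}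

/-! ### States `j^a u^a` and the gauge-covariant derivative -/

theorem pd_mul (μ : Fin d) (f g : SmoothFn d) : pd μ (f * g) = pd μ f * g + f * pd μ g := by
  apply Subtype.ext
  funext x
  change fderiv ℝ (f.1 * g.1) x (Pi.single μ 1) = _
  rw [fderiv_mul (f.differentiable x) (g.differentiable x)]
  change f.1 x * _ + g.1 x * _ = _ * g.1 x + f.1 x * _
  rw [add_comm, mul_comm (g.1 x)]
  rfl

/-- The linear map `f ↦ f(X) δ(γ)`. -/
def fnLin (𝔤 : Type*) [LieRing 𝔤] [LieAlgebra ℝ 𝔤] (d : ℕ) : SmoothFn d →ₗ[ℂ] State 𝔤 d :=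
  (TensorProduct.mk ℂ _ _).flip ((1 : Bos d) ⊗ₜ[ℂ] ((1 : Fer d) ⊗ₜ[ℂ] curVac 𝔤))

/-- The state `∑_a j^a u^a δ(γ)` of an adjoint-valued function `u`. -/
def multiplet : (ι → SmoothFn d) →ₗ[ℂ] State 𝔤 d :=
  ∑ i, opJ (e i) (-1) ∘ₗ fnLin 𝔤 d ∘ₗ LinearMap.proj i

theorem multiplet_apply (u : ι → SmoothFn d) :
    multiplet e u = ∑ i, opJ (e i) (-1) (fnState 𝔤 (u i)) := by
  simp only [multiplet, LinearMap.sum_apply]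
  rfl

theorem bAnn_fnState (i : BMode d) (f : SmoothFn d) : bAnn i (fnState 𝔤 f) = 0 := by
  rw [fnState, bAnn, onBos_tmul, Derivation.coeFn_coe, Derivation.map_one_eq_zero,
    TensorProduct.zero_tmul, TensorProduct.tmul_zero]

theorem fAnn_fnState (i : FMode d) (f : SmoothFn d) : fAnn i (fnState 𝔤 f) = 0 := by
  rw [fnState, fAnn, onFer_tmul, CliffordAlgebra.contractLeft_one, TensorProduct.zero_tmul,
    TensorProduct.tmul_zero, TensorProduct.tmul_zero]

theorem opJ_fnState_mem_quiet (x : 𝔤) (f : SmoothFn d) :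
    opJ x (-1) (fnState 𝔤 f) ∈ quiet 𝔤 d := by
  refine mem_quiet.mpr ⟨fun i => mem_ker_of_commute (onBos_onCur _ _) (bAnn_fnState i f),
    fun y n => ?_⟩
  have h := opJ_vac y (n + 1) f
  rw [Nat.cast_add, Nat.cast_one] at h
  rw [opJ_opJ, h, map_zero, zero_add, add_neg_cancel_right, opJ_vac]

theorem multiplet_mem_quiet (u : ι → SmoothFn d) : multiplet e u ∈ quiet 𝔤 d := by
  rw [multiplet_apply]
  exact sum_mem fun i _ => opJ_fnState_mem_quiet _ _

theorem fAnn_multiplet (i : FMode d) (u : ι → SmoothFn d) : fAnn i (multiplet e u) = 0 := by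
  rw [multiplet_apply]
  exact (LinearMap.ker (fAnn i)).sum_mem fun j _ =>
    mem_ker_of_commute (onFer_onCur _ _) (fAnn_fnState i _)

theorem onFn_multiplet (T : Module.End ℂ (SmoothFn d)) (u : ι → SmoothFn d) :
    onFn T (multiplet e u) = multiplet e fun i => T (u i) := by
  simp only [multiplet_apply, map_sum]
  refine Finset.sum_congr rfl fun i _ => ?_
  rw [opJ, ← Module.End.mul_apply, (onFn_onCur _ _).eq, Module.End.mul_apply, fnState, onFn_tmul]
  rfl

/-- `(F ⋆ u)^a = f^{abc} F^b u^c`. -/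
def adMul (F u : ι → SmoothFn d) : ι → SmoothFn d :=
  fun a => ∑ b, ∑ c, structConst e a b c • (F b * u c)

theorem covD_eq (A : Fin d → ι → SmoothFn d) (μ : Fin d) (u : ι → SmoothFn d) :
    covD e A μ u = (fun i => pd μ (u i)) + adMul e (A μ) u := rfl

/-- The covariant derivative on states. -/
def covOp (A : Fin d → ι → SmoothFn d) (μ : Fin d) : Module.End ℂ (State 𝔤 d) :=
  onFn (pd μ) + ∑ a, mulFn (A μ a) ∘ₗ opJ (e a) 0

theorem covOp_apply (A : Fin d → ι → SmoothFn d) (μ : Fin d) (v : State 𝔤 d) :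
    covOp e A μ v = onFn (pd μ) v + ∑ a, mulFn (A μ a) (opJ (e a) 0 v) := by
  simp only [covOp, LinearMap.add_apply, LinearMap.sum_apply, LinearMap.comp_apply]

section Killing

variable [DecidableEq ι] {C : ℝ} (hC : C ≠ 0)
  (he : ∀ a b, killingForm ℝ 𝔤 (e a) (e b) = if a = b then -C else 0)

include hC he

/-- The vacuum is killed by `j_(0)`, so only the commutator with `j_(-1)` remains; cyclicity moves
the structure constants from the currents to the coefficient functions. -/
theorem opJ_multiplet (b : ι) (u : ι → SmoothFn d) :
    opJ (e b) 0 (multiplet e u) = multiplet e fun a => ∑ c, structConst e a b c • u c := by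
  have hz (x : 𝔤) (f : SmoothFn d) : opJ x 0 (fnState 𝔤 f) = 0 := opJ_vac x 0 f
  have hs (s : ι → ℂ) : fnState 𝔤 (∑ c, s c • u c) = ∑ c, s c • fnState 𝔤 (u c) :=
    (map_sum (fnLin 𝔤 d) _ _).trans (Finset.sum_congr rfl fun c _ => map_smul (fnLin 𝔤 d) _ _)
  simp only [multiplet_apply, map_sum, opJ_opJ _ (e b), hz, map_zero, zero_add, opJ_lie, hs,
    map_smul]
  rw [Finset.sum_comm]
  simp only [structConst_cyclic e hC he _ b]

theorem sum_mulFn_opJ_multiplet (F u : ι → SmoothFn d) :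
    ∑ b, mulFn (F b) (opJ (e b) 0 (multiplet e u)) = multiplet e (adMul e F u) := by
  simp only [opJ_multiplet e hC he, mulFn, onFn_multiplet, ← map_sum]
  congr 1
  funext a
  simp only [Finset.sum_apply, adMul, LinearMap.mulLeft_apply, Finset.mul_sum, mul_smul_comm]

/-- The quadratic Casimir of the adjoint representation. With the Sugawara prefactor `-1/C` it gives
the current weight 1. -/
theorem casimir_multiplet (u : ι → SmoothFn d) :
    ∑ a, opJ (e a) 0 (opJ (e a) 0 (multiplet e u)) = -(C : ℂ) • multiplet e u := by
  simp only [opJ_multiplet e hC he, ← map_sum, ← map_smul]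
  congr 1
  funext k
  simp only [Finset.sum_apply, Pi.smul_apply, Finset.smul_sum, smul_smul]
  have h (i : ι) : ∑ a, ∑ c, structConst e k a c * structConst e c a i =
      if k = i then -(C : ℂ) else 0 := by
    rw [← neg_inj, ← Finset.sum_neg_distrib]
    rw [show -(if k = i then -(C : ℂ) else 0) = if k = i then (C : ℂ) else 0 by
      split_ifs <;> simp, ← sum_structConst_mul e hC he]
    refine Finset.sum_congr rfl fun a _ => ?_
    rw [← Finset.sum_neg_distrib]
    refine Finset.sum_congr rfl fun c _ => ?_
    rw [structConst_antisymm e c a i, structConst_cyclic e hC he a c i,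
      structConst_cyclic e hC he c i a, mul_neg, neg_neg]
  calc _ = ∑ i, (∑ a, ∑ c, structConst e k a c * structConst e c a i) • u i := by
        simp only [Finset.sum_smul]
        conv_rhs => rw [Finset.sum_comm]
        exact Finset.sum_congr rfl fun a _ => Finset.sum_comm
    _ = _ := by simp only [h, ite_smul, zero_smul, Finset.sum_ite_eq, Finset.mem_univ, if_true]

theorem covOp_multiplet (A : Fin d → ι → SmoothFn d) (μ : Fin d) (u : ι → SmoothFn d) :
    covOp e A μ (multiplet e u) = multiplet e (covD e A μ u) := by
  rw [covOp_apply, sum_mulFn_opJ_multiplet e hC he, onFn_multiplet, covD_eq, map_add]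

end Killing

theorem onFer_covOp (T : Module.End ℂ (Fer d)) (A : Fin d → ι → SmoothFn d) (μ : Fin d)
    (v : State 𝔤 d) : onFer T (covOp e A μ v) = covOp e A μ (onFer T v) := by
  have h₁ (S : Module.End ℂ (SmoothFn d)) (w : State 𝔤 d) :
      onFer T (onFn S w) = onFn S (onFer T w) := (LinearMap.congr_fun (onFn_onFer S T).eq w).symm
  have h₂ (x : 𝔤) (w : State 𝔤 d) : onFer T (opJ x 0 w) = opJ x 0 (onFer T w) :=
    LinearMap.congr_fun (onFer_onCur T _).eq w
  simp only [covOp_apply, map_add, map_sum, mulFn, h₁, h₂]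

theorem onFn_pd_mulFn (μ : Fin d) (f : SmoothFn d) (v : State 𝔤 d) :
    onFn (pd μ) (mulFn f v) = mulFn (pd μ f) v + mulFn f (onFn (pd μ) v) := by
  refine LinearMap.congr_fun (f := onFn (pd μ) ∘ₗ mulFn f)
    (g := mulFn (pd μ f) + mulFn f ∘ₗ onFn (pd μ)) (State.hom_ext fun g p w u => ?_) v
  simp only [LinearMap.comp_apply, LinearMap.add_apply, mulFn, onFn_tmul, LinearMap.mulLeft_apply,
    pd_mul, TensorProduct.add_tmul]

theorem mulFn_mul (f g : SmoothFn d) (v : State 𝔤 d) : mulFn (f * g) v = mulFn f (mulFn g v) := by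
  refine LinearMap.congr_fun (f := mulFn (f * g)) (g := mulFn f ∘ₗ mulFn g)
    (State.hom_ext fun h p w u => ?_) v
  simp only [LinearMap.comp_apply, mulFn, onFn_tmul, LinearMap.mulLeft_apply, mul_assoc]

theorem onFn_opJ (T : Module.End ℂ (SmoothFn d)) (x : 𝔤) (n : ℤ) (v : State 𝔤 d) :
    opJ x n (onFn T v) = onFn T (opJ x n v) :=
  (LinearMap.congr_fun (onFn_onCur T _).eq v).symm

/-- Expanding the square, the Leibniz rule for `∂(A ·)` produces the `∂A` term and one of the two
equal mixed terms. The right side has the shape in which `curH_one` delivers the kinetic part of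
`H_(1)`. -/
theorem covOp_covOp (A : Fin d → ι → SmoothFn d) (μ : Fin d) (v : State 𝔤 d) :
    covOp e A μ (covOp e A μ v) = onFn (pd μ) (onFn (pd μ) v)
      + (2 : ℂ) • ∑ a, mulFn (A μ a) (opJ (e a) 0 (onFn (pd μ) v))
      + ∑ a, ∑ b, mulFn (A μ a * A μ b) (opJ (e b) 0 (opJ (e a) 0 v))
      + ∑ a, mulFn (pd μ (A μ a)) (opJ (e a) 0 v) := by
  have h (f : SmoothFn d) (b : ι) (w : State 𝔤 d) :
      opJ (e b) 0 (mulFn f w) = mulFn f (opJ (e b) 0 w) := onFn_opJ _ _ _ _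
  have h' (a b : ι) (w : State 𝔤 d) :
      mulFn (A μ a * A μ b) w = mulFn (A μ b) (mulFn (A μ a) w) := by
    rw [mul_comm, mulFn_mul]
  have hd (b : ι) : opJ (e b) 0 (onFn (pd μ) v) = onFn (pd μ) (opJ (e b) 0 v) := onFn_opJ _ _ _ _
  have h₁ : onFn (pd μ) (∑ b, mulFn (A μ b) (opJ (e b) 0 v)) =
      ∑ b, mulFn (pd μ (A μ b)) (opJ (e b) 0 v) +
        ∑ b, mulFn (A μ b) (onFn (pd μ) (opJ (e b) 0 v)) := by
    rw [map_sum, ← Finset.sum_add_distrib]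
    exact Finset.sum_congr rfl fun b _ => onFn_pd_mulFn μ _ _
  have h₂ : ∑ a, mulFn (A μ a) (opJ (e a) 0 (∑ b, mulFn (A μ b) (opJ (e b) 0 v))) =
      ∑ a, ∑ b, mulFn (A μ a * A μ b) (opJ (e b) 0 (opJ (e a) 0 v)) := by
    -- The two sides have the zero modes of `j` in opposite order; since the functions `A` commute,
    -- exchanging the names of the summation indices reconciles them.
    rw [Finset.sum_comm]
    refine Finset.sum_congr rfl fun a _ => ?_
    rw [map_sum, map_sum]
    exact Finset.sum_congr rfl fun b _ => by rw [h, h']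
  have h₃ : ∑ a, mulFn (A μ a) (opJ (e a) 0 (onFn (pd μ) v + ∑ b, mulFn (A μ b) (opJ (e b) 0 v))) =
      ∑ a, mulFn (A μ a) (opJ (e a) 0 (onFn (pd μ) v)) +
        ∑ a, mulFn (A μ a) (opJ (e a) 0 (∑ b, mulFn (A μ b) (opJ (e b) 0 v))) := by
    rw [← Finset.sum_add_distrib]
    exact Finset.sum_congr rfl fun a _ => by rw [map_add, map_add]
  rw [covOp_apply e A μ (covOp e A μ v), covOp_apply e A μ v, h₃, h₂, map_add, h₁, two_smul]
  simp only [hd]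
  abel

theorem fieldStrength_antisymm [DecidableEq ι] {C : ℝ} (hC : C ≠ 0)
    (he : ∀ a b, killingForm ℝ 𝔤 (e a) (e b) = if a = b then -C else 0)
    (A : Fin d → ι → SmoothFn d) (μ ν : Fin d) :
    fieldStrength e A μ ν = -fieldStrength e A ν μ := by
  funext a
  rw [Pi.neg_apply, fieldStrength, fieldStrength, neg_add, neg_sub, ← Finset.sum_neg_distrib,
    Finset.sum_comm]
  congr 1
  refine Finset.sum_congr rfl fun b _ => ?_
  rw [← Finset.sum_neg_distrib]
  refine Finset.sum_congr rfl fun c _ => ?_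
  rw [← structConst_cyclic e hC he b a c, structConst_antisymm e b a c, neg_smul, mul_comm]

/-- Antisymmetry in the last two indices of `f`, obtained from cyclicity and antisymmetry in the
first two. -/
theorem adMul_antisymm [DecidableEq ι] {C : ℝ} (hC : C ≠ 0)
    (he : ∀ a b, killingForm ℝ 𝔤 (e a) (e b) = if a = b then -C else 0)
    (F u : ι → SmoothFn d) : adMul e F u = -adMul e u F := by
  funext a
  rw [Pi.neg_apply, adMul, adMul, ← Finset.sum_neg_distrib, Finset.sum_comm]
  refine Finset.sum_congr rfl fun b _ => ?_
  rw [← Finset.sum_neg_distrib]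
  refine Finset.sum_congr rfl fun c _ => ?_
  rw [← structConst_cyclic e hC he b a c, structConst_antisymm e b a c, neg_smul, mul_comm]

theorem adMul_neg (F u : ι → SmoothFn d) : adMul e F (-u) = -adMul e F u := by
  funext a
  rw [Pi.neg_apply, adMul, adMul, ← Finset.sum_neg_distrib]
  refine Finset.sum_congr rfl fun b _ => ?_
  rw [← Finset.sum_neg_distrib]
  refine Finset.sum_congr rfl fun c _ => ?_
  rw [Pi.neg_apply, show F b * -u c = -(F b * u c) from
    Subtype.ext (mul_neg (F b).1 (u c).1), smul_neg]

theorem linYM_eq (A a : Fin d → ι → SmoothFn d) (ν : Fin d) :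
    linYM e A a ν = ∑ μ, eta μ • covD e A μ (covD e A μ (a ν)) +
      (2 : ℂ) • ∑ μ, eta μ • adMul e (a μ) (fieldStrength e A μ ν) := by
  funext i
  simp only [linYM, Pi.add_apply, Finset.sum_apply, Pi.smul_apply, adMul, Finset.smul_sum]
  congr 1
  conv_rhs => rw [Finset.sum_comm]
  refine Finset.sum_congr rfl fun b _ => ?_
  conv_rhs => rw [Finset.sum_comm]
  refine Finset.sum_congr rfl fun c _ => Finset.sum_congr rfl fun μ _ => ?_
  rw [smul_comm (eta μ)]

end Multiplets

/-! ### Evaluation of `Q V`, one summand of `Q` at a time. -/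

section Vertex

variable {𝔤 ι : Type*} [LieRing 𝔤] [LieAlgebra ℝ 𝔤] [Fintype ι] (e : Module.Basis ι ℝ 𝔤) {d : ℕ}

/-! ### The BRST operator on the gluon vertex operator -/

/-- The operators `c c̄` in front of a vertex operator. -/
def ccbar (𝔤 : Type*) [LieRing 𝔤] [LieAlgebra ℝ 𝔤] (d : ℕ) : Module.End ℂ (State 𝔤 d) :=
  fCre (.c 0) ∘ₗ fCre (.cbar 0)

theorem ccbar_apply (v : State 𝔤 d) : ccbar 𝔤 d v = fCre (.c 0) (fCre (.cbar 0) v) := rfl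

theorem fCre_ccbar (i : FMode d) (v : State 𝔤 d) :
    fCre i (ccbar 𝔤 d v) = ccbar 𝔤 d (fCre i v) := by
  rw [ccbar_apply, fCre_fCre, fCre_fCre _ i, map_neg, neg_neg, ccbar_apply]

theorem fAnn_ccbar {i : FMode d} (h₁ : .c 0 ≠ i) (h₂ : .cbar 0 ≠ i) (v : State 𝔤 d) :
    fAnn i (ccbar 𝔤 d v) = ccbar 𝔤 d (fAnn i v) := by
  rw [ccbar_apply, fAnn_fCre_of_ne _ h₁, fAnn_fCre_of_ne _ h₂, map_neg, neg_neg, ccbar_apply]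

theorem covOp_ccbar (A : Fin d → ι → SmoothFn d) (μ : Fin d) (v : State 𝔤 d) :
    covOp e A μ (ccbar 𝔤 d v) = ccbar 𝔤 d (covOp e A μ v) := by
  rw [ccbar_apply, fCre, ← onFer_covOp, fCre, ← onFer_covOp]
  rfl

theorem ccbar_mem_quiet {v : State 𝔤 d} (hv : v ∈ quiet 𝔤 d) : ccbar 𝔤 d v ∈ quiet 𝔤 d :=
  onFer_mem_quiet _ (onFer_mem_quiet _ hv)

/-- The matter part `ψ^μ a_μ^a j^a δ(γ)` of the vertex operator. -/
def matterV (a : Fin d → ι → SmoothFn d) : State 𝔤 d := ∑ μ, fCre (.ψ μ 0) (multiplet e (a μ))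

theorem gluonV_eq (a : Fin d → ι → SmoothFn d) : gluonV e a = ccbar 𝔤 d (matterV e a) := by
  simp only [matterV, multiplet_apply, map_sum]
  rfl

theorem matterV_mem_quiet (a : Fin d → ι → SmoothFn d) : matterV e a ∈ quiet 𝔤 d :=
  sum_mem fun _ _ => onFer_mem_quiet _ (multiplet_mem_quiet e _)

theorem gluonV_mem_quiet (a : Fin d → ι → SmoothFn d) : gluonV e a ∈ quiet 𝔤 d := by
  rw [gluonV_eq]
  exact ccbar_mem_quiet (matterV_mem_quiet e a)

theorem fAnn_matterV {i : FMode d} (hi : ∀ μ, .ψ μ 0 ≠ i) (a : Fin d → ι → SmoothFn d) :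
    fAnn i (matterV e a) = 0 := by
  rw [matterV, map_sum]
  refine Finset.sum_eq_zero fun μ _ => ?_
  rw [fAnn_fCre_of_ne _ (hi μ), fAnn_multiplet, map_zero, neg_zero]

theorem fAnn_psi_matterV (ν : Fin d) (a : Fin d → ι → SmoothFn d) :
    fAnn (.ψ ν 0) (matterV e a) = multiplet e (a ν) := by
  rw [matterV, map_sum, Finset.sum_eq_single ν]
  · rw [fAnn_fCre_self, fAnn_multiplet, map_zero, sub_zero]
  · intro μ _ hμ
    rw [fAnn_fCre_of_ne _ (by simpa using hμ), fAnn_multiplet, map_zero, neg_zero]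
  · simp

theorem fAnn_gluonV {i : FMode d} (h₁ : .c 0 ≠ i) (h₂ : .cbar 0 ≠ i) (hi : ∀ μ, .ψ μ 0 ≠ i)
    (a : Fin d → ι → SmoothFn d) : fAnn i (gluonV e a) = 0 := by
  rw [gluonV_eq, fAnn_ccbar h₁ h₂, fAnn_matterV e hi, map_zero]

theorem fAnn_psi_gluonV (ν : Fin d) (a : Fin d → ι → SmoothFn d) :
    fAnn (.ψ ν 0) (gluonV e a) = ccbar 𝔤 d (multiplet e (a ν)) := by
  rw [gluonV_eq, fAnn_ccbar (by simp) (by simp), fAnn_psi_matterV]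

theorem fPsi_zero_gluonV (ν : Fin d) (a : Fin d → ι → SmoothFn d) :
    fPsi ν 0 (gluonV e a) = eta ν • ccbar 𝔤 d (multiplet e (a ν)) :=
  congrArg (eta ν • ·) (fAnn_psi_gluonV e ν a)

theorem psiQuiet_gluonV (a : Fin d → ι → SmoothFn d) : PsiQuiet (gluonV e a) where
  high μ k := fAnn_gluonV e (by simp) (by simp) (by simp) a
  two μ ν := by
    rw [fAnn_psi_gluonV, fAnn_ccbar (by simp) (by simp), fAnn_multiplet, map_zero]

theorem cbarFilled_gluonV (a : Fin d → ι → SmoothFn d) : CbarFilled (gluonV e a) where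
  bbar k := fAnn_gluonV e (by simp) (by simp) (by simp) a
  high k := fAnn_gluonV e (by simp) (by simp) (by simp) a
  fill := by rw [gluonV_eq, ccbar_apply, fCre_fCre, fCre_self, map_zero, neg_zero]

theorem fCre_c_gluonV (a : Fin d → ι → SmoothFn d) : fCre (.c 0) (gluonV e a) = 0 := by
  rw [gluonV_eq, ccbar_apply, fCre_self]

theorem fPsi_neg_one (μ : Fin d) (v : State 𝔤 d) : fPsi μ (-1) v = fCre (.ψ μ 0) v := rfl

theorem eta_mul_eta (μ : Fin d) : eta μ * eta μ = 1 := by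
  rw [eta]; split_ifs <;> simp

section Killing

variable [DecidableEq ι] {C : ℝ} (hC : C ≠ 0)
  (he : ∀ a b, killingForm ℝ 𝔤 (e a) (e b) = if a = b then -C else 0)

include hC he

theorem curG_gluonV (A a : Fin d → ι → SmoothFn d) :
    curG e A 1 (gluonV e a) = -ccbar 𝔤 d (multiplet e (lorenz e A a)) := by
  rw [curG_one e (gluonV_mem_quiet e a) (psiQuiet_gluonV e a), lorenz, map_sum, map_sum]
  congr 1
  refine Finset.sum_congr rfl fun μ _ => ?_
  rw [← covOp_apply, fPsi_zero_gluonV, map_smul, covOp_ccbar, covOp_multiplet e hC he, map_smul,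
    map_smul]

theorem sum_mulFn_opJ_fCre (F u : ι → SmoothFn d) (i : FMode d) :
    ∑ b, mulFn (F b) (opJ (e b) 0 (ccbar 𝔤 d (fCre i (multiplet e u)))) =
      ccbar 𝔤 d (fCre i (multiplet e (adMul e F u))) := by
  have h₁ (f : SmoothFn d) (T : Module.End ℂ (Fer d)) (w : State 𝔤 d) :
      mulFn f (onFer T w) = onFer T (mulFn f w) := LinearMap.congr_fun (onFn_onFer _ T).eq w
  have h₂ (x : 𝔤) (T : Module.End ℂ (Fer d)) (w : State 𝔤 d) :
      opJ x 0 (onFer T w) = onFer T (opJ x 0 w) :=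
    (LinearMap.congr_fun (onFer_onCur T _).eq w).symm
  rw [← sum_mulFn_opJ_multiplet e hC he]
  simp only [ccbar_apply, fCre, h₁, h₂, map_sum]

/-- The squared covariant derivatives pass through the fermionic factors and act on `a`. The
rotation of the `ψ` index by the antisymmetric `F` gives two equal terms, hence the factor 2 of the
linearised equation. -/
theorem curH_gluonV (A a : Fin d → ι → SmoothFn d) :
    curH e A 1 (gluonV e a) =
      ccbar 𝔤 d (∑ ν, fCre (.ψ ν 0) (multiplet e (linYM e A a ν))) := by
  rw [curH_one e (gluonV_mem_quiet e a) (psiQuiet_gluonV e a)]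
  simp only [← covOp_covOp, fPsi_zero_gluonV, fPsi_neg_one, map_smul, fCre_ccbar]
  have h₁ : ∑ μ, eta μ • covOp e A μ (covOp e A μ (gluonV e a)) =
      ∑ ν, ccbar 𝔤 d (fCre (.ψ ν 0)
        (multiplet e (∑ μ, eta μ • covD e A μ (covD e A μ (a ν))))) := by
    simp only [gluonV_eq, covOp_ccbar, matterV, map_sum, fCre, ← onFer_covOp,
      covOp_multiplet e hC he, map_smul, Finset.smul_sum]
    exact Finset.sum_comm
  have h₂ (μ ν : Fin d) : ∑ b, mulFn (fieldStrength e A μ ν b) (opJ (e b) 0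
        (eta ν • ccbar 𝔤 d (fCre (.ψ μ 0) (multiplet e (a ν))) -
          eta μ • ccbar 𝔤 d (fCre (.ψ ν 0) (multiplet e (a μ))))) =
      ccbar 𝔤 d (fCre (.ψ μ 0)
        (multiplet e (eta ν • adMul e (a ν) (fieldStrength e A ν μ)))) +
      ccbar 𝔤 d (fCre (.ψ ν 0)
        (multiplet e (eta μ • adMul e (a μ) (fieldStrength e A μ ν)))) := by
    simp only [map_sub, map_smul, Finset.sum_sub_distrib, ← Finset.smul_sum,
      sum_mulFn_opJ_fCre e hC he]
    have e₁ : adMul e (fieldStrength e A μ ν) (a ν) = adMul e (a ν) (fieldStrength e A ν μ) := by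
      rw [adMul_antisymm e hC he, fieldStrength_antisymm e hC he A μ ν, adMul_neg, neg_neg]
    rw [e₁, adMul_antisymm e hC he _ (a μ), map_neg, map_neg, map_neg, smul_neg, sub_neg_eq_add]
  simp only [h₁, h₂, Finset.sum_add_distrib]
  -- After renaming `μ` and `ν` in one of the two halves of the `F` term, both halves are the same
  -- sum.
  rw [Finset.sum_comm (f := fun μ ν => ccbar 𝔤 d (fCre (.ψ ν 0)
        (multiplet e (eta μ • adMul e (a μ) (fieldStrength e A μ ν)))))]
  rw [map_sum, ← two_smul ℂ, Finset.smul_sum, ← Finset.sum_add_distrib]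
  refine Finset.sum_congr rfl fun ν _ => ?_
  rw [linYM_eq]
  simp only [map_add, map_sum, map_smul]

/-- The weights add up to 1/2 + 1 - 1/2 = 1; the middle one is the Casimir, where the normalisation
`1/C` cancels. -/
theorem stressT_gluonV (a : Fin d → ι → SmoothFn d) :
    stressT e C 1 (gluonV e a) = gluonV e a := by
  rw [stressT_one e (gluonV_mem_quiet e a) (psiQuiet_gluonV e a) (cbarFilled_gluonV e a)]
  have h₁ : ∑ μ, eta μ • fPsi μ (-1) (fPsi μ 0 (gluonV e a)) = gluonV e a := by
    simp only [fPsi_zero_gluonV, fPsi_neg_one, map_smul, smul_smul, eta_mul_eta, one_smul,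
      fCre_ccbar]
    rw [gluonV_eq, matterV, map_sum]
  have h₂ : ∑ b, opJ (e b) 0 (opJ (e b) 0 (gluonV e a)) = -(C : ℂ) • gluonV e a := by
    have h (x : 𝔤) (T : Module.End ℂ (Fer d)) (w : State 𝔤 d) :
        opJ x 0 (onFer T w) = onFer T (opJ x 0 w) :=
      (LinearMap.congr_fun (onFer_onCur T _).eq w).symm
    rw [gluonV_eq]
    simp only [matterV, ccbar_apply, fCre, h, map_sum]
    rw [Finset.sum_comm, Finset.smul_sum]
    refine Finset.sum_congr rfl fun μ _ => ?_
    simp only [← map_sum, casimir_multiplet e hC he, map_smul]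
  have hC' : (C : ℂ) ≠ 0 := by exact_mod_cast hC
  rw [h₁, h₂, smul_smul, mul_neg, inv_mul_cancel₀ hC']
  module

end Killing

theorem fAnn_c_zero_gluonV (a : Fin d → ι → SmoothFn d) :
    fAnn (.c 0) (gluonV e a) = fCre (.cbar 0) (matterV e a) := by
  rw [gluonV_eq, ccbar_apply, fAnn_fCre_self, fAnn_fCre_of_ne _ (by simp),
    fAnn_matterV e (by simp), map_zero, neg_zero, map_zero, sub_zero]

theorem fC_gluonV {n : ℤ} (hn : -1 ≤ n) (a : Fin d → ι → SmoothFn d) : fC n (gluonV e a) = 0 := by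
  rcases n with n | (_ | n)
  · exact fAnn_gluonV e (by simp) (by simp) (by simp) a
  · exact fCre_c_gluonV e a
  · omega

theorem fC_fB_gluonV {n : ℤ} (hn : 0 ≤ n) (a : Fin d → ι → SmoothFn d) :
    fC n (fB 0 (gluonV e a)) = 0 := by
  lift n to ℕ using hn
  change fAnn (.b n) (fAnn (.c 0) (gluonV e a)) = 0
  rw [fAnn_fAnn, fAnn_gluonV e (by simp) (by simp) (by simp), map_zero, neg_zero]

theorem fB_gluonV {n : ℤ} (hn : 0 < n) (a : Fin d → ι → SmoothFn d) : fB n (gluonV e a) = 0 := by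
  obtain ⟨k, rfl⟩ : ∃ k : ℕ, n = Int.ofNat (k + 1) := ⟨(n - 1).toNat, by
    rw [Int.ofNat_eq_natCast]; omega⟩
  exact fAnn_gluonV e (by simp) (by simp) (by simp) a

theorem c_del_c_gluonV {n : ℤ} (hn : 0 ≤ n) (a : Fin d → ι → SmoothFn d) :
    nopF fC (del fC) n (gluonV e a) = 0 := by
  rw [nopF, nopSign_eq _ stable_bot_c stable_bot_c.del
    (fun k hk => by rw [del_apply, fC_gluonV e (by omega), smul_zero])
    (fun m hm => fC_gluonV e (by omega) a), del_apply, fC_gluonV e (by omega), smul_zero,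
    stable_bot_c.map_zero, fC_gluonV e (by omega), stable_bot_c.del.map_zero, smul_zero, add_zero]

/-- Only `b_(0)`, which removes the factor `c`, acts nontrivially; `c ∂c` then puts back `c_(-1)
c_(-2)`. The sign is opposite to that of `c_stressT_gluonV`, and the two cancel. -/
theorem b_c_del_c_gluonV (a : Fin d → ι → SmoothFn d) :
    nop fB (nopF fC (del fC)) 0 (gluonV e a) = -fC (-2) (gluonV e a) := by
  have hs := stable_bot_c (𝔤 := 𝔤) (d := d) |>.nopF stable_bot_c.del
  rw [nop, nopSign_eq _ stable_bot_b hs (fun k hk => c_del_c_gluonV e hk.le a)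
    (fun m hm => fB_gluonV e hm a), c_del_c_gluonV e le_rfl, stable_bot_b.map_zero, zero_add,
    one_smul, zero_sub, nopF, nopSign_eq _ stable_bot_c stable_bot_c.del
    (fun k hk => by
      obtain rfl | hk : k = 0 ∨ 0 < k := by omega
      · simp [del_apply]
      · rw [del_apply, fC_fB_gluonV e (by omega), smul_zero])
    (fun m hm => fC_fB_gluonV e hm.le a), fC_fB_gluonV e le_rfl, stable_bot_c.del.map_zero,
    smul_zero, add_zero, del_apply]
  -- Exchanging `c_(-1)` and `c_(-2)` costs the sign, and `c_(-1) b_(0) V = V`.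
  change fCre (.c 0) ((-((-1 : ℤ) : ℂ)) • fCre (.c 1) (fAnn (.c 0) (gluonV e a))) =
    -fCre (.c 1) (gluonV e a)
  rw [fAnn_c_zero_gluonV, gluonV_eq, ccbar_apply, map_smul, fCre_fCre _ (.c 0)]
  simp

theorem c_stressT_gluonV [DecidableEq ι] {C : ℝ} (hC : C ≠ 0)
    (he : ∀ a b, killingForm ℝ 𝔤 (e a) (e b) = if a = b then -C else 0)
    (a : Fin d → ι → SmoothFn d) :
    nop fC (stressT e C) 0 (gluonV e a) = fC (-2) (gluonV e a) := by
  have h0 : Stable ⊥ (stressT e C (d := d)) := ghostStable_bot.stressT e C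
  have h1 : fC (-1) (stressT e C 0 (gluonV e a)) = 0 :=
    ghostStable_ker_fCre_c.stressT e C 0 _ (fCre_c_gluonV e a)
  rw [nop, nopSign_eq_three, h1, fC_gluonV e (by omega), h0.map_zero, smul_zero, add_zero,
    add_zero, zero_add, stressT_gluonV e hC he]
  · intro m hm
    rw [stressT_of_two_le e (gluonV_mem_quiet e a) (psiQuiet_gluonV e a) (cbarFilled_gluonV e a) _
      (by omega), stable_bot_c.map_zero]
  · intro m hm
    rw [fC_gluonV e (by omega), h0.map_zero]

theorem gamma_curG_gluonV (A a : Fin d → ι → SmoothFn d) :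
    nop fGamma (curG e A) 0 (gluonV e a) = fGamma (-2) (curG e A 1 (gluonV e a)) := by
  have h0 : Stable ⊥ (curG e A) := ghostStable_bot.curG e A
  have hq := gluonV_mem_quiet e a
  have hb := (mem_quiet.mp hq).1
  have h1 : fGamma (-1) (curG e A 0 (gluonV e a)) = 0 :=
    matterStable_ker_bAnn_beta.curG e A 0 _ (hb _)
  rw [nop, nopSign_eq_three, h1, fGamma_of_neg_one_le hb (by omega), h0.map_zero, smul_zero,
    add_zero, add_zero, zero_add]
  · intro m hm
    rw [curG_of_two_le e hq (psiQuiet_gluonV e a) _ (by omega), ghostStable_bot.gamma.map_zero]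
  · intro m hm
    rw [fGamma_of_neg_one_le hb (by omega), h0.map_zero]

theorem cbar_curH_gluonV (A a : Fin d → ι → SmoothFn d) :
    nop fCbar (curH e A) 0 (gluonV e a) = fCbar (-2) (curH e A 1 (gluonV e a)) := by
  have h0 : Stable ⊥ (curH e A) := ghostStable_bot.curH e A
  have hq := gluonV_mem_quiet e a
  have hc := cbarFilled_gluonV e a
  have h1 : fCbar (-1) (curH e A 0 (gluonV e a)) = 0 :=
    (matterStable_ker_fCre (by simp)).curH e A 0 _ hc.fill
  rw [nop, nopSign_eq_three, h1, hc.cbar_of_nonneg (by omega), h0.map_zero, smul_zero,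
    add_zero, add_zero, zero_add]
  · intro m hm
    rw [curH_of_two_le e hq (psiQuiet_gluonV e a) _ (by omega), ghostStable_bot.cbar.map_zero]
  · intro m hm
    rw [hc.cbar_of_nonneg (by omega), h0.map_zero]

theorem bbar_gamma_gamma_gluonV (a : Fin d → ι → SmoothFn d) :
    nop fBbar (nop fGamma fGamma) 0 (gluonV e a) = 0 := by
  have hb := (mem_quiet.mp (gluonV_mem_quiet e a)).1
  have hc := cbarFilled_gluonV e a
  have hs := ghostStable_bot (𝔤 := 𝔤) (d := d) |>.gamma.nop ghostStable_bot.gamma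
  rw [nop, nopSign_eq _ ghostStable_bot.bbar hs (fun k hk => gamma_gamma hb (by omega))
    (fun m hm => hc.bbar_of_pos hm), gamma_gamma hb (by omega), ghostStable_bot.bbar.map_zero,
    zero_add, one_smul]
  refine gamma_gamma (fun i => ?_) (by omega)
  exact (mem_quiet.mp (onFer_mem_quiet _ (gluonV_mem_quiet e a))).1 i

theorem brstQ_gluonV [DecidableEq ι] {C : ℝ} (hC : C ≠ 0)
    (he : ∀ a b, killingForm ℝ 𝔤 (e a) (e b) = if a = b then -C else 0)
    (A a : Fin d → ι → SmoothFn d) :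
    brstQ e C A (gluonV e a) = ccbar 𝔤 d
      (∑ ν, fCre (.cbar 1) (fCre (.ψ ν 0) (multiplet e (linYM e A a ν)))
        - bCre (.γ 0) (multiplet e (lorenz e A a))) := by
  simp only [brstQ, Pi.add_apply, Pi.sub_apply, Pi.smul_apply, c_stressT_gluonV e hC he,
    b_c_del_c_gluonV, gamma_curG_gluonV, cbar_curH_gluonV, bbar_gamma_gamma_gluonV,
    curG_gluonV e hC he, curH_gluonV e hC he, smul_zero, sub_zero, add_neg_cancel, zero_add]
  change bCre (.γ 0) (-ccbar 𝔤 d _) + fCre (.cbar 1) (ccbar 𝔤 d _) = _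
  have h (w : State 𝔤 d) : bCre (.γ 0) (ccbar 𝔤 d w) = ccbar 𝔤 d (bCre (.γ 0) w) := by
    have h' (T : Module.End ℂ (Fer d)) (w : State 𝔤 d) :
        bCre (.γ 0) (onFer T w) = onFer T (bCre (.γ 0) w) :=
      LinearMap.congr_fun (onBos_onFer _ T).eq w
    rw [ccbar_apply, fCre, h', fCre, h']
    rfl
  rw [map_neg, h, fCre_ccbar, map_sub, map_sum, neg_add_eq_sub]

theorem brst_image_eq (A a : Fin d → ι → SmoothFn d) :
    ∑ i, fC (-1) (fCbar (-1)
        ((∑ ν, fCbar (-2) (fPsi ν (-1) (fJ (e i) (-1) (fnState 𝔤 (linYM e A a ν i)))))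
          - fGamma (-2) (fJ (e i) (-1) (fnState 𝔤 (lorenz e A a i))))) =
      ccbar 𝔤 d
      (∑ ν, fCre (.cbar 1) (fCre (.ψ ν 0) (multiplet e (linYM e A a ν)))
        - bCre (.γ 0) (multiplet e (lorenz e A a))) := by
  simp only [multiplet_apply, map_sum]
  rw [Finset.sum_comm (s := Finset.univ (α := Fin d)), ← Finset.sum_sub_distrib, map_sum]
  rfl

end Vertex

/-! ### A geometric model that detects degree one of the vacuum module. -/

section Grassmannian

/-! ### Vector fields on the big cell of the loop Grassmannian

The level-zero vacuum module is nontrivial in degree one: the loop algebra acts on the polynomial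
functions on the big cell of the Grassmannian of `ℤ × ι`-indexed loops by Riccati vector fields,
and the vector fields of the nonnegative modes vanish at the origin. -/

variable (ι : Type*)

/-- Polynomial functions in the matrix entries `z_{(i,a),(j,b)}`: the row `(i, a)` belongs to the
loop degree `-i-1`, the column `(j, b)` to the loop degree `j`. -/
abbrev CellRing : Type _ := MvPolynomial ((ℕ × ι) × (ℕ × ι)) ℂ

/-- Loops with finitely many nonnegative modes. -/
def Tail : Submodule (CellRing ι) (ℤ → ι → CellRing ι) where
  carrier := {g | ∃ N : ℕ, ∀ m : ℕ, N ≤ m → g m = 0}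
  add_mem' := by
    rintro g h ⟨N, hN⟩ ⟨M, hM⟩
    exact ⟨max N M, fun m hm => by
      rw [Pi.add_apply, hN m (le_trans (le_max_left _ _) hm),
        hM m (le_trans (le_max_right _ _) hm), add_zero]⟩
  zero_mem' := ⟨0, fun _ _ => rfl⟩
  smul_mem' := by
    rintro p g ⟨N, hN⟩
    exact ⟨N, fun m hm => by rw [Pi.smul_apply, hN m hm, smul_zero]⟩

variable {ι}

theorem Tail.ext {g h : Tail ι} (h₁ : ∀ i a, g.1 (Int.negSucc i) a = h.1 (Int.negSucc i) a)
    (h₂ : ∀ (m : ℕ) a, g.1 m a = h.1 m a) : g = h := by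
  apply Subtype.ext
  funext m a
  rcases m with m | i
  · exact h₂ m a
  · exact h₁ i a

/-- Entrywise application of a derivation. -/
def Tail.mapD (D : Derivation ℂ (CellRing ι) (CellRing ι)) : Tail ι →ₗ[ℂ] Tail ι where
  toFun g := ⟨fun m a => D (g.1 m a), by
    obtain ⟨N, hN⟩ := g.2
    exact ⟨N, fun m hm => by 
      funext a
      change D (g.1 m a) = 0
      rw [hN m hm, Pi.zero_apply, map_zero]⟩⟩
  map_add' g h := by
    apply Subtype.ext
    funext m a
    exact map_add D _ _
  map_smul' c g := by
    apply Subtype.ext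
    funext m a
    exact D.map_smul _ _

/-- The shift of the loop degree by `n`. -/
def Tail.shift (n : ℤ) : Module.End (CellRing ι) (Tail ι) where
  toFun g := ⟨fun m => g.1 (m - n), by
    obtain ⟨N, hN⟩ := g.2
    refine ⟨N + n.natAbs, fun m hm => ?_⟩
    obtain ⟨k, hk⟩ : ∃ k : ℕ, (m : ℤ) - n = k := ⟨(m - n).toNat, by omega⟩
    change g.1 (m - n) = 0
    rw [hk]
    exact hN k (by omega)⟩
  map_add' _ _ := rfl
  map_smul' _ _ := rfl

/-- The shifts, as a representation of the Laurent polynomials. -/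
def Tail.shiftHom : AddMonoidAlgebra ℂ ℤ →ₐ[ℂ] Module.End (CellRing ι) (Tail ι) :=
  AddMonoidAlgebra.lift ℂ _ ℤ
    { toFun := fun n => Tail.shift n.toAdd
      map_one' := LinearMap.ext fun g => Subtype.ext <| funext fun m => congrArg g.1 (sub_zero m)
      map_mul' := fun n k => LinearMap.ext fun g => Subtype.ext <| funext fun m =>
        congrArg g.1 (by rw [toAdd_mul]; ring) }

theorem Tail.shiftHom_single (n : ℤ) :
    Tail.shiftHom (ι := ι) (AddMonoidAlgebra.single n 1) = Tail.shift n := by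
  rw [Tail.shiftHom, AddMonoidAlgebra.lift_single, one_smul]
  rfl

variable [Fintype ι]

/-- The action of constant matrices. -/
def Tail.mat : Matrix ι ι ℂ →ₗ[ℂ] Module.End (CellRing ι) (Tail ι) where
  toFun M :=
    { toFun := fun g => ⟨fun m a => ∑ c, M a c • g.1 m c, by
        obtain ⟨N, hN⟩ := g.2
        exact ⟨N, fun m hm => by funext a; simp [hN m hm]⟩⟩
      map_add' := fun g h => by
        apply Subtype.ext
        funext m a
        simp [Finset.sum_add_distrib]
      map_smul' := fun p g => by
        apply Subtype.ext
        funext m a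
        simp [Finset.mul_sum] }
  map_add' M M' := by
    refine LinearMap.ext fun g => ?_
    apply Subtype.ext
    funext m a
    simp [add_smul, Finset.sum_add_distrib]
  map_smul' c M := by
    refine LinearMap.ext fun g => ?_
    apply Subtype.ext
    funext m a
    simp [Finset.smul_sum, mul_smul]

theorem Tail.mat_mul [DecidableEq ι] (M M' : Matrix ι ι ℂ) :
    Tail.mat (M * M') = Tail.mat M * Tail.mat M' := by
  refine LinearMap.ext fun g => ?_
  apply Subtype.ext
  funext m a
  change ∑ c, (M * M') a c • g.1 m c = ∑ b, M a b • ∑ c, M' b c • g.1 m c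
  simp only [Matrix.mul_apply, Finset.sum_smul, Finset.smul_sum, mul_smul]
  exact Finset.sum_comm

theorem Tail.shiftHom_comm_mat (p : AddMonoidAlgebra ℂ ℤ) (M : Matrix ι ι ℂ) :
    Commute (Tail.shiftHom p) (Tail.mat M) := by
  induction p using AddMonoidAlgebra.induction_on with
  | of n =>
    rw [show AddMonoidAlgebra.of ℂ ℤ (Multiplicative.ofAdd n) = AddMonoidAlgebra.single n 1 from rfl,
      Tail.shiftHom_single]
    rfl
  | add p q hp hq => rw [map_add]; exact hp.add_left hq
  | smul c p hp => rw [map_smul]; exact hp.smul_left c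

theorem Tail.finsum_eq {g : Tail ι} {N : ℕ} (hN : ∀ m : ℕ, N ≤ m → g.1 m = 0)
    (q : ℕ × ι) :
    ∑ᶠ m : ℕ, ∑ c, MvPolynomial.X (q, (m, c)) * g.1 m c =
      ∑ m ∈ Finset.range N, ∑ c, MvPolynomial.X (q, (m, c)) * g.1 m c := by
  refine finsum_eq_sum_of_support_subset _ fun m hm => ?_
  by_contra h
  rw [Finset.coe_range, Set.mem_Iio, not_lt] at h
  refine hm (Finset.sum_eq_zero fun c _ => ?_)
  rw [hN m h, Pi.zero_apply, mul_zero]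

/-- The projection to the negative modes along the subspace with coordinates `z`. -/
def Tail.proj : Tail ι →ₗ[CellRing ι] ℕ → ι → CellRing ι where
  toFun g i a := g.1 (Int.negSucc i) a -
    ∑ᶠ m : ℕ, ∑ c, MvPolynomial.X ((i, a), (m, c)) * g.1 m c
  map_add' g h := by
    obtain ⟨N, hN⟩ := g.2
    obtain ⟨M, hM⟩ := h.2
    have hN' (m : ℕ) (hm : max N M ≤ m) := hN m (le_trans (le_max_left _ _) hm)
    have hM' (m : ℕ) (hm : max N M ≤ m) := hM m (le_trans (le_max_right _ _) hm)
    have hNM (m : ℕ) (hm : max N M ≤ m) : (g + h).1 m = 0 := by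
      change g.1 m + h.1 m = 0
      rw [hN' m hm, hM' m hm, add_zero]
    funext i a
    rw [Tail.finsum_eq hNM]
    simp only [Pi.add_apply]
    rw [Tail.finsum_eq hN', Tail.finsum_eq hM', sub_add_sub_comm, ← Finset.sum_add_distrib]
    congr 1
    refine Finset.sum_congr rfl fun m _ => ?_
    rw [← Finset.sum_add_distrib]
    exact Finset.sum_congr rfl fun c _ => mul_add _ _ _
  map_smul' p g := by
    obtain ⟨N, hN⟩ := g.2
    have hN' (m : ℕ) (hm : N ≤ m) : (p • g).1 m = 0 := by
      change p • g.1 m = 0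
      rw [hN m hm, smul_zero]
    funext i a
    simp only [RingHom.id_apply, Pi.smul_apply]
    rw [Tail.finsum_eq hN', Tail.finsum_eq hN, smul_eq_mul, mul_sub, Finset.mul_sum]
    congr 1
    refine Finset.sum_congr rfl fun m _ => ?_
    rw [Finset.mul_sum]
    exact Finset.sum_congr rfl fun c _ => mul_left_comm _ _ _

theorem Tail.proj_apply {g : Tail ι} {N : ℕ} (hN : ∀ m : ℕ, N ≤ m → g.1 m = 0) (i : ℕ) (a : ι) :
    Tail.proj g i a = g.1 (Int.negSucc i) a -
      ∑ m ∈ Finset.range N, ∑ c, MvPolynomial.X ((i, a), (m, c)) * g.1 m c := by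
  rw [← Tail.finsum_eq hN]
  rfl

/-- The projection as an endomorphism. -/
def Tail.neg (g : Tail ι) : Tail ι where
  val
    | Int.negSucc i, a => Tail.proj g i a
    | Int.ofNat _, _ => 0
  property := ⟨0, fun _ _ => rfl⟩

variable [DecidableEq ι]

/-- The basis of the subspace with coordinates `z`. -/
def Tail.frame (q : ℕ × ι) : Tail ι where
  val
    | Int.negSucc i, a => MvPolynomial.X ((i, a), q)
    | Int.ofNat m, a => if (m, a) = q then 1 else 0
  property := ⟨q.1 + 1, fun m hm => by
    funext a
    exact if_neg fun h => by rw [← h] at hm; omega⟩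

/-- Loops split into purely negative ones and the graph spanned by the frame. A frame vector has one
nonnegative entry, so the coefficients are the nonnegative entries of `g`. -/
theorem Tail.eq_neg_add {g : Tail ι} {N : ℕ} (hN : ∀ m : ℕ, N ≤ m → g.1 m = 0) :
    g = Tail.neg g + ∑ m ∈ Finset.range N, ∑ c, g.1 m c • Tail.frame (m, c) := by
  have h (k : ℤ) (a : ι) :
      (∑ m ∈ Finset.range N, ∑ c, g.1 m c • Tail.frame (m, c)).1 k a =
        ∑ m ∈ Finset.range N, ∑ c, g.1 m c * (Tail.frame (m, c)).1 k a := by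
    simp [Finset.sum_apply]
  refine Tail.ext (fun i a => ?_) fun k a => ?_
  · change _ = Tail.proj g i a + (∑ m ∈ Finset.range N, ∑ c, g.1 m c • Tail.frame (m, c)).1 _ a
    rw [Tail.proj_apply hN, h, sub_add_eq_add_sub, eq_sub_iff_add_eq]
    congr 1
    exact Finset.sum_congr rfl fun m _ => Finset.sum_congr rfl fun c _ => mul_comm _ _
  · change _ = 0 + (∑ m ∈ Finset.range N, ∑ c, g.1 m c • Tail.frame (m, c)).1 _ a
    rw [h, zero_add]
    have h' (m : ℕ) (c : ι) : g.1 m c * (Tail.frame (m, c)).1 k a =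
        if k = m then (if a = c then g.1 m c else 0) else 0 := by
      change _ * (if (k, a) = (m, c) then 1 else 0) = _
      rw [mul_ite, mul_one, mul_zero, ← ite_and]
      simp only [Prod.mk.injEq]
    simp only [h', Finset.sum_ite_eq, Finset.mem_univ, if_true, Finset.sum_ite_irrel,
      Finset.sum_const_zero, Finset.mem_range]
    split_ifs with hk
    · rfl
    · rw [hN k (not_lt.mp hk), Pi.zero_apply]

/-- The Riccati vector field of an endomorphism. -/
def vectorField : Module.End (CellRing ι) (Tail ι) →ₗ[ℂ]
    Derivation ℂ (CellRing ι) (CellRing ι) where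
  toFun S := MvPolynomial.mkDerivation ℂ fun q => Tail.proj (S (Tail.frame q.2)) q.1.1 q.1.2
  map_add' S T := MvPolynomial.derivation_ext fun q => by
    rw [Derivation.add_apply]
    simp only [MvPolynomial.mkDerivation_X, LinearMap.add_apply, map_add, Pi.add_apply]
  map_smul' c S := MvPolynomial.derivation_ext fun q => by
    rw [Derivation.smul_apply]
    simp only [MvPolynomial.mkDerivation_X, LinearMap.smul_apply, RingHom.id_apply]
    rw [← algebraMap_smul (CellRing ι) c (S (Tail.frame q.2)), map_smul, Pi.smul_apply,
      Pi.smul_apply, algebraMap_smul]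

theorem vectorField_X (S : Module.End (CellRing ι) (Tail ι)) (q : (ℕ × ι) × (ℕ × ι)) :
    vectorField S (MvPolynomial.X q) = Tail.proj (S (Tail.frame q.2)) q.1.1 q.1.2 :=
  MvPolynomial.mkDerivation_X ..

theorem mapD_frame (S : Module.End (CellRing ι) (Tail ι)) (q : ℕ × ι) :
    Tail.mapD (vectorField S) (Tail.frame q) = Tail.neg (S (Tail.frame q)) := by
  refine Tail.ext (fun i a => vectorField_X S _) fun m a => ?_
  change vectorField S (if (m, a) = q then 1 else 0) = 0
  split_ifs
  · exact Derivation.map_one_eq_zero _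
  · exact map_zero _

/-- Differentiate the splitting of `g` into its negative part and a combination of frame vectors,
using `mapD_frame`, and project: the frame itself projects to zero, and its motion contributes the
projection of `S (g - neg g)`. -/
theorem vectorField_proj (S : Module.End (CellRing ι) (Tail ι)) (g : Tail ι) (i : ℕ) (a : ι) :
    vectorField S (Tail.proj g i a) =
      Tail.proj (Tail.mapD (vectorField S) g - S g + S (Tail.neg g)) i a := by
  obtain ⟨N, hN⟩ := g.2
  have hD (m : ℕ) (hm : N ≤ m) : (Tail.mapD (vectorField S) g).1 m = 0 := by
    funext c
    change vectorField S (g.1 m c) = 0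
    rw [hN m hm, Pi.zero_apply, map_zero]
  have hS : S g - S (Tail.neg g) =
      ∑ m ∈ Finset.range N, ∑ c, g.1 m c • S (Tail.frame (m, c)) := by
    have h := congrArg S (Tail.eq_neg_add hN)
    simp only [map_add, map_sum, map_smul] at h
    exact sub_eq_of_eq_add' h
  rw [sub_add, hS, map_sub, Pi.sub_apply, Pi.sub_apply, Tail.proj_apply hN, Tail.proj_apply hD]
  simp only [map_sub, map_sum, Derivation.leibniz, vectorField_X, smul_eq_mul, Finset.sum_apply,
    Finset.sum_add_distrib, map_smul, Pi.smul_apply]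
  rw [sub_sub]
  rfl

/-- Endomorphisms with constant coefficients. -/
def constEnd (ι : Type*) [Fintype ι] : Set (Module.End (CellRing ι) (Tail ι)) :=
  {S | ∀ D g, Tail.mapD D (S g) = S (Tail.mapD D g)}

/-- Constant coefficients let the derivations pass through `S` and `T` onto the frame, where
`vectorField_proj` applies; the terms with `Tail.neg` cancel. Note the reversed order: this is an
antihomomorphism. -/
theorem vectorField_comm {S T : Module.End (CellRing ι) (Tail ι)} (hS : S ∈ constEnd ι)
    (hT : T ∈ constEnd ι) (p : CellRing ι) :
    vectorField T (vectorField S p) - vectorField S (vectorField T p) =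
      vectorField (S * T - T * S) p := by
  have h : ⁅vectorField T, vectorField S⁆ = vectorField (S * T - T * S) := by
    refine MvPolynomial.derivation_ext fun q => ?_
    rw [Derivation.commutator_apply]
    simp only [vectorField_X, vectorField_proj, hS _ _, hT _ _, mapD_frame]
    simp only [map_sub, map_add, Pi.sub_apply, Pi.add_apply, LinearMap.sub_apply,
      Module.End.mul_apply]
    ring
  rw [← h, Derivation.commutator_apply]

omit [DecidableEq ι] in
theorem shift_mem_constEnd (p : AddMonoidAlgebra ℂ ℤ) : Tail.shiftHom p ∈ constEnd ι := by
  intro D g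
  induction p using AddMonoidAlgebra.induction_on with
  | of n =>
    rw [show AddMonoidAlgebra.of ℂ ℤ (Multiplicative.ofAdd n) = AddMonoidAlgebra.single n 1 from rfl,
      Tail.shiftHom_single]
    rfl
  | add p q hp hq => rw [map_add, LinearMap.add_apply, map_add, hp, hq, LinearMap.add_apply]
  | smul c p hp => rw [map_smul, LinearMap.smul_apply, map_smul, hp, LinearMap.smul_apply]

omit [DecidableEq ι] in
theorem mat_mem_constEnd (M : Matrix ι ι ℂ) : Tail.mat M ∈ constEnd ι := by
  intro D g
  apply Subtype.ext
  funext m a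
  change D (∑ c, M a c • g.1 m c) = ∑ c, M a c • D (g.1 m c)
  rw [map_sum]
  exact Finset.sum_congr rfl fun c _ => D.map_smul _ _

/-- At the origin the frame vectors are pure monomial loops and the projection just takes the
negative modes, so a matrix entry is left whenever the loop degrees match. -/
theorem constantCoeff_vectorField_single {n : ℤ} (M : Matrix ι ι ℂ) (q : (ℕ × ι) × (ℕ × ι)) :
    MvPolynomial.constantCoeff (vectorField (Tail.shift n * Tail.mat M) (MvPolynomial.X q)) =
      if Int.negSucc q.1.1 - n = q.2.1 then M q.1.2 q.2.2 else 0 := by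
  have h0 (g : Tail ι) (i : ℕ) (a : ι) : MvPolynomial.constantCoeff (Tail.proj g i a) =
      MvPolynomial.constantCoeff (g.1 (Int.negSucc i) a) := by
    obtain ⟨N, hN⟩ := g.2
    rw [Tail.proj_apply hN]
    simp
  have hf (k : ℤ) (c : ι) : MvPolynomial.constantCoeff ((Tail.frame q.2).1 k c) =
      if k = q.2.1 ∧ c = q.2.2 then (1 : ℂ) else 0 := by
    rcases k with k | k
    · change MvPolynomial.constantCoeff (if (k, c) = q.2 then 1 else 0) = _
      rw [apply_ite MvPolynomial.constantCoeff, map_one, map_zero]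
      simp [Prod.ext_iff]
    · change MvPolynomial.constantCoeff (MvPolynomial.X _) = _
      rw [MvPolynomial.constantCoeff_X, if_neg]
      rintro ⟨h, -⟩
      simp at h
  rw [vectorField_X, h0]
  change MvPolynomial.constantCoeff
    (∑ c, M q.1.2 c • (Tail.frame q.2).1 (Int.negSucc q.1.1 - n) c) = _
  simp only [map_sum, MvPolynomial.constantCoeff_smul, hf, smul_eq_mul, mul_ite, mul_one, mul_zero,
    ite_and]
  split_ifs <;> simp

/-- A derivation that vanishes at the origin on the coordinates vanishes there. -/
theorem constantCoeff_derivation {σ : Type*} (D : Derivation ℂ (MvPolynomial σ ℂ) (MvPolynomial σ ℂ))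
    (h : ∀ k, MvPolynomial.constantCoeff (D (MvPolynomial.X k)) = 0) (p : MvPolynomial σ ℂ) :
    MvPolynomial.constantCoeff (D p) = 0 := by
  induction p using MvPolynomial.induction_on with
  | C a => simp
  | add p q hp hq => rw [map_add, map_add, hp, hq, add_zero]
  | mul_X p k hp => simp [Derivation.leibniz, h, hp]

end Grassmannian

/-! ### The loop algebra acting on distributions, and the map from the vacuum module. -/

section LoopAction

variable {𝔤 ι : Type*} [LieRing 𝔤] [LieAlgebra ℝ 𝔤] [Fintype ι] [DecidableEq ι]
  (e : Module.Basis ι ℝ 𝔤)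

attribute [local instance 100] LieRing.ofAssociativeRing

/-- The adjoint matrices of the complexified Lie algebra. -/
def adMat : ℂ ⊗[ℝ] 𝔤 →ₗ[ℂ] Matrix ι ι ℂ :=
  (LinearMap.toMatrix (e.baseChange ℂ) (e.baseChange ℂ)).toLinearMap ∘ₗ
    (LieAlgebra.ad ℂ (ℂ ⊗[ℝ] 𝔤)).toLinearMap

theorem adMat_lie (x y : ℂ ⊗[ℝ] 𝔤) :
    adMat e ⁅x, y⁆ = adMat e x * adMat e y - adMat e y * adMat e x := by
  simp only [adMat, LinearMap.comp_apply, LinearEquiv.coe_coe, LieHom.coe_toLinearMap,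
    LieHom.map_lie, LieRing.of_associative_ring_bracket, map_sub, LinearMap.toMatrix_mul]

theorem adMat_basis (i a b : ι) : adMat e ((1 : ℂ) ⊗ₜ[ℝ] e i) a b = structConst e i b a := by
  simp [adMat, LinearMap.toMatrix_apply, LieAlgebra.ExtendScalars.bracket_tmul, structConst]

/-- The action of the loop algebra on loops in its adjoint representation. -/
def loopEnd : Loop 𝔤 →ₗ[ℂ] Module.End (CellRing ι) (Tail ι) :=
  TensorProduct.lift ((LinearMap.mul ℂ (Module.End (CellRing ι) (Tail ι))).compl₁₂
    Tail.shiftHom.toLinearMap (Tail.mat ∘ₗ adMat e))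

theorem loopEnd_tmul (p : AddMonoidAlgebra ℂ ℤ) (y : ℂ ⊗[ℝ] 𝔤) :
    loopEnd e (p ⊗ₜ[ℂ] y) = Tail.shiftHom p * Tail.mat (adMat e y) := rfl

theorem loopEnd_lie (X Y : Loop 𝔤) :
    loopEnd e ⁅X, Y⁆ = loopEnd e X * loopEnd e Y - loopEnd e Y * loopEnd e X := by
  induction X using TensorProduct.induction_on with
  | zero =>
    rw [show ⁅(0 : Loop 𝔤), Y⁆ = 0 from zero_lie (L := Loop 𝔤) Y, map_zero, zero_mul,
      mul_zero]
    exact (sub_self (G := Module.End (CellRing ι) (Tail ι)) 0).symm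
  | add X X' h h' =>
    rw [show ⁅(X + X' : Loop 𝔤), Y⁆ = ⁅(X : Loop 𝔤), Y⁆ + ⁅(X' : Loop 𝔤), Y⁆ from
      add_lie (L := Loop 𝔤) X X' Y, map_add, h, h', map_add, add_mul, mul_add]
    abel
  | tmul p x =>
    induction Y using TensorProduct.induction_on with
    | zero =>
      rw [show ⁅(p ⊗ₜ[ℂ] x : Loop 𝔤), (0 : Loop 𝔤)⁆ = 0 from lie_zero (L := Loop 𝔤) _, map_zero,
        zero_mul, mul_zero]
      exact (sub_self (G := Module.End (CellRing ι) (Tail ι)) 0).symm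
    | add Y Y' h h' =>
      rw [show ⁅(p ⊗ₜ[ℂ] x : Loop 𝔤), (Y + Y' : Loop 𝔤)⁆ =
        ⁅(p ⊗ₜ[ℂ] x : Loop 𝔤), (Y : Loop 𝔤)⁆ + ⁅(p ⊗ₜ[ℂ] x : Loop 𝔤), (Y' : Loop 𝔤)⁆ from
        lie_add (L := Loop 𝔤) _ Y Y', map_add, h, h', map_add, add_mul, mul_add]
      abel
    | tmul q y =>
      rw [LieAlgebra.ExtendScalars.bracket_tmul]
      simp only [loopEnd_tmul, adMat_lie, map_sub, map_mul, Tail.mat_mul]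
      have h (p q : AddMonoidAlgebra ℂ ℤ) (M N : Matrix ι ι ℂ) :
          Tail.shiftHom p * Tail.mat M * (Tail.shiftHom q * Tail.mat N) =
            Tail.shiftHom p * Tail.shiftHom q * (Tail.mat M * Tail.mat N) := by
        rw [mul_assoc, ← mul_assoc (Tail.mat M), ← (Tail.shiftHom_comm_mat q M).eq, mul_assoc,
          mul_assoc]
      have hc : Tail.shiftHom (ι := ι) q * Tail.shiftHom p = Tail.shiftHom p * Tail.shiftHom q := by
        rw [← map_mul, mul_comm, map_mul]
      rw [h, h, hc]
      exact mul_sub (α := Module.End (CellRing ι) (Tail ι)) _ _ _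

theorem loopEnd_mem_constEnd (X : Loop 𝔤) : loopEnd e X ∈ constEnd ι := by
  intro D g
  induction X using TensorProduct.induction_on with
  | zero => simp
  | add X X' h h' => rw [map_add, LinearMap.add_apply, map_add, h, h', LinearMap.add_apply]
  | tmul p x =>
    rw [loopEnd_tmul, Module.End.mul_apply, shift_mem_constEnd, mat_mem_constEnd,
      Module.End.mul_apply]

/-- The representation of the loop algebra on distributions on the big cell. -/
def cellRep : Loop 𝔤 →ₗ⁅ℂ⁆ Module.End ℂ (Module.Dual ℂ (CellRing ι)) where
  toFun X := Module.Dual.transpose (R := ℂ) (vectorField (loopEnd e X)).toLinearMap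
  map_add' X Y := by
    refine LinearMap.ext fun φ => LinearMap.ext fun p => ?_
    change φ (vectorField (loopEnd e (X + Y)) p) =
      φ (vectorField (loopEnd e X) p) + φ (vectorField (loopEnd e Y) p)
    rw [map_add, map_add, Derivation.add_apply, map_add]
  map_smul' c X := by
    refine LinearMap.ext fun φ => LinearMap.ext fun p => ?_
    change φ (vectorField (loopEnd e (c • X)) p) = c • φ (vectorField (loopEnd e X) p)
    rw [map_smul, map_smul, Derivation.smul_apply, map_smul]
  map_lie' {X Y} := by
    refine LinearMap.ext fun φ => LinearMap.ext fun p => ?_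
    rw [LieRing.of_associative_ring_bracket]
    change φ (vectorField (loopEnd e ⁅X, Y⁆) p) =
      φ (vectorField (loopEnd e Y) (vectorField (loopEnd e X) p)) -
        φ (vectorField (loopEnd e X) (vectorField (loopEnd e Y) p))
    -- The vector fields and the transpose each reverse commutators, so together they preserve them.
    rw [← map_sub, vectorField_comm (loopEnd_mem_constEnd e X) (loopEnd_mem_constEnd e Y),
      loopEnd_lie]

/-- Evaluation at the origin. -/
def cellDelta (ι : Type*) : Module.Dual ℂ (CellRing ι) :=
  (MvPolynomial.aeval (0 : (ℕ × ι) × (ℕ × ι) → ℂ)).toLinearMap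

omit [Fintype ι] [DecidableEq ι] in
theorem cellDelta_apply (p : CellRing ι) : cellDelta ι p = MvPolynomial.constantCoeff p := by
  simp [cellDelta, MvPolynomial.aeval_zero]

theorem cellRep_loopElt_X (x : 𝔤) (n : ℤ) (q : (ℕ × ι) × (ℕ × ι)) :
    cellRep e (loopElt x n) (cellDelta ι) (MvPolynomial.X q) =
      if Int.negSucc q.1.1 - n = q.2.1 then adMat e ((1 : ℂ) ⊗ₜ[ℝ] x) q.1.2 q.2.2 else 0 := by
  change cellDelta ι (vectorField (loopEnd e (loopElt x n)) (MvPolynomial.X q)) = _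
  rw [cellDelta_apply, loopElt, loopEnd_tmul, Tail.shiftHom_single,
    constantCoeff_vectorField_single]

/-- The origin is the subspace of nonnegative loops, which multiplication by `t^n` with `n ≥ 0`
preserves; the vector field therefore vanishes there. -/
theorem cellRep_loopElt_of_nonneg (x : 𝔤) (n : ℕ) :
    cellRep e (loopElt x n) (cellDelta ι) = 0 := by
  refine LinearMap.ext fun p => ?_
  change cellDelta ι (vectorField (loopEnd e (loopElt x n)) p) = 0
  rw [cellDelta_apply]
  refine constantCoeff_derivation _ (fun q => ?_) p
  have h := cellRep_loopElt_X e x n q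
  rw [if_neg (by rw [Int.negSucc_eq]; omega)] at h
  rw [← cellDelta_apply]
  exact h

/-- The map from the vacuum module to distributions that sends the vacuum to the delta function. -/
def curToCell : Cur 𝔤 →ₗ[ℂ] Module.Dual ℂ (CellRing ι) :=
  ((annihIdeal 𝔤).restrictScalars ℂ).liftQ
    (LinearMap.applyₗ (cellDelta ι) ∘ₗ
      (UniversalEnvelopingAlgebra.lift ℂ (cellRep e)).toLinearMap) (by
    intro u hu
    rw [LinearMap.mem_ker]
    change UniversalEnvelopingAlgebra.lift ℂ (cellRep e) u (cellDelta ι) = 0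
    replace hu : u ∈ annihIdeal 𝔤 := hu
    induction hu using Submodule.span_induction with
    | mem u h =>
      obtain ⟨x, n, rfl⟩ := h
      rw [UniversalEnvelopingAlgebra.lift_ι_apply, cellRep_loopElt_of_nonneg]
    | zero => simp
    | add u u' _ _ h h' => rw [map_add, LinearMap.add_apply, h, h', add_zero]
    | smul r u _ h => rw [smul_eq_mul, map_mul, Module.End.mul_apply, h, map_zero]) ∘ₗ
    (Submodule.Quotient.restrictScalarsEquiv ℂ (annihIdeal 𝔤)).symm.toLinearMap

theorem curToCell_ι (x : 𝔤) (n : ℤ) :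
    curToCell e ((UniversalEnvelopingAlgebra.ι ℂ (loopElt x n) : LoopU 𝔤) • curVac 𝔤) =
      cellRep e (loopElt x n) (cellDelta ι) := by
  change UniversalEnvelopingAlgebra.lift ℂ (cellRep e)
    (UniversalEnvelopingAlgebra.ι ℂ (loopElt x n) * 1) (cellDelta ι) = _
  rw [mul_one, UniversalEnvelopingAlgebra.lift_ι_apply]

end LoopAction

/-! ### Recovering the field equations from the vanishing of the state. -/

section Injectivity

variable {𝔤 ι : Type*} [LieRing 𝔤] [LieAlgebra ℝ 𝔤] [Fintype ι] [DecidableEq ι]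
  (e : Module.Basis ι ℝ 𝔤) {d : ℕ}

/-- The coefficient function of a state with respect to a functional on the current algebra
module and the vacua of the other fields. -/
def coeffFn (φ : Cur 𝔤 →ₗ[ℂ] ℂ) : State 𝔤 d →ₗ[ℂ] SmoothFn d :=
  (TensorProduct.rid ℂ (SmoothFn d)).toLinearMap ∘ₗ LinearMap.lTensor (SmoothFn d)
    (LinearMap.mul' ℂ ℂ ∘ₗ TensorProduct.map (MvPolynomial.aeval (0 : BMode d → ℂ)).toLinearMap
      (LinearMap.mul' ℂ ℂ ∘ₗ TensorProduct.map
        (ExteriorAlgebra.algebraMapInv (R := ℂ) (M := FMode d →₀ ℂ)).toLinearMap φ))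

theorem coeffFn_tmul (φ : Cur 𝔤 →ₗ[ℂ] ℂ) (f : SmoothFn d) (u : Cur 𝔤) :
    coeffFn φ (f ⊗ₜ[ℂ] ((1 : Bos d) ⊗ₜ[ℂ] ((1 : Fer d) ⊗ₜ[ℂ] u))) = φ u • f := by
  simp only [coeffFn, LinearMap.comp_apply, LinearMap.lTensor_tmul, TensorProduct.map_tmul,
    LinearMap.mul'_apply, AlgHom.toLinearMap_apply, map_one, one_mul, LinearEquiv.coe_coe,
    TensorProduct.rid_tmul]

theorem opJ_fnState (x : 𝔤) (n : ℤ) (f : SmoothFn d) :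
    opJ x n (fnState 𝔤 f) = f ⊗ₜ[ℂ] ((1 : Bos d) ⊗ₜ[ℂ] ((1 : Fer d) ⊗ₜ[ℂ]
      ((UniversalEnvelopingAlgebra.ι ℂ (loopElt x n) : LoopU 𝔤) • curVac 𝔤))) := by
  rw [opJ, fnState, onCur_tmul, Algebra.lsmul_coe]

/-- Testing against coordinates shows that `u` is killed by the adjoint representation; contracting
once more with the structure constants turns this into `C u = 0`. -/
theorem eq_zero_of_multiplet_eq_zero {C : ℝ} (hC : C ≠ 0)
    (he : ∀ a b, killingForm ℝ 𝔤 (e a) (e b) = if a = b then -C else 0)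
    {u : ι → SmoothFn d} (h : multiplet e u = 0) (j : ι) : u j = 0 := by
  have key (a b : ι) : ∑ i, structConst e i b a • u i = 0 := by
    -- This coordinate has row degree -1 and column degree 0, so at the origin the mode -1 moves it
    -- at the rate given by an entry of the adjoint matrix.
    have h' := congrArg (coeffFn (LinearMap.applyₗ
      (MvPolynomial.X ((0, a), (0, b)) : CellRing ι) ∘ₗ curToCell e)) h
    rw [multiplet_apply, map_sum, map_zero] at h'
    rw [← h']
    refine Finset.sum_congr rfl fun i _ => ?_
    rw [opJ_fnState, coeffFn_tmul, LinearMap.comp_apply, curToCell_ι, LinearMap.applyₗ_apply_apply,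
      cellRep_loopElt_X, if_pos (by simp), adMat_basis]
  have hsum : ∑ b, ∑ a, structConst e j b a • ∑ i, structConst e i b a • u i = (C : ℂ) • u j := by
    calc _ = ∑ i, (∑ b, ∑ a, structConst e j b a * structConst e i b a) • u i := by
          simp only [Finset.smul_sum, Finset.sum_smul, smul_smul]
          conv_rhs => rw [Finset.sum_comm]
          exact Finset.sum_congr rfl fun b _ => Finset.sum_comm
      _ = _ := by
          simp only [sum_structConst_mul e hC he, ite_smul, zero_smul, Finset.sum_ite_eq,
            Finset.mem_univ, if_true]
  simp only [key, smul_zero, Finset.sum_const_zero] at hsum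
  exact (smul_eq_zero.mp hsum.symm).resolve_left (by exact_mod_cast hC)

theorem bAnn_fCre (i : BMode d) (j : FMode d) (v : State 𝔤 d) :
    bAnn i (fCre j v) = fCre j (bAnn i v) :=
  LinearMap.congr_fun (onBos_onFer _ _).eq v

theorem fAnn_bCre (i : BMode d) (j : FMode d) (v : State 𝔤 d) :
    fAnn j (bCre i v) = bCre i (fAnn j v) :=
  (LinearMap.congr_fun (onBos_onFer _ _).eq v).symm

theorem eq_zero_of_ccbar_eq_zero {v : State 𝔤 d} (h₁ : fAnn (.c 0) v = 0)
    (h₂ : fAnn (.cbar 0) v = 0) (h : ccbar 𝔤 d v = 0) : v = 0 := by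
  have h' := congrArg (fun w => fAnn (.cbar 0) (fAnn (.c 0) w)) h
  simpa only [ccbar_apply, fAnn_fCre_self, fAnn_fCre_of_ne _ (show FMode.cbar 0 ≠ .c 0 by simp),
    h₁, h₂, map_zero, neg_zero, sub_zero] using h'

/-- The two kinds of terms carry different oscillators: the derivative along `γ_(-2)` isolates `u`,
and contraction with `c̄_(-2)` and then `ψ^ν_(-1)` isolates `y ν`. -/
theorem ccbar_eq_zero_iff {C : ℝ} (hC : C ≠ 0)
    (he : ∀ a b, killingForm ℝ 𝔤 (e a) (e b) = if a = b then -C else 0)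
    (y : Fin d → ι → SmoothFn d) (u : ι → SmoothFn d) :
    ccbar 𝔤 d (∑ ν, fCre (.cbar 1) (fCre (.ψ ν 0) (multiplet e (y ν)))
      - bCre (.γ 0) (multiplet e u)) = 0 ↔ (∀ i, u i = 0) ∧ ∀ ν i, y ν i = 0 := by
  constructor
  · intro h
    have hf {i : FMode d} (h₁ : .cbar 1 ≠ i) (h₂ : ∀ ν, .ψ ν 0 ≠ i) :
        fAnn i (∑ ν, fCre (.cbar 1) (fCre (.ψ ν 0) (multiplet e (y ν)))
          - bCre (.γ 0) (multiplet e u)) = 0 := by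
      simp only [map_sub, map_sum, fAnn_fCre_of_ne _ h₁, fAnn_fCre_of_ne _ (h₂ _), fAnn_multiplet,
        fAnn_bCre, map_zero, neg_zero, Finset.sum_const_zero, sub_zero]
    have h0 := eq_zero_of_ccbar_eq_zero (hf (by simp) (by simp)) (hf (by simp) (by simp)) h
    have hb (w : ι → SmoothFn d) : bAnn (.γ 0) (multiplet e w) = 0 :=
      (mem_quiet.mp (multiplet_mem_quiet e w)).1 _
    constructor
    · refine eq_zero_of_multiplet_eq_zero e hC he ?_
      have h' := congrArg (bAnn (.γ 0)) h0
      simpa only [map_sub, map_sum, bAnn_fCre, hb, map_zero, Finset.sum_const_zero, bAnn_bCre_self,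
        add_zero, zero_sub, neg_eq_zero] using h'
    · intro ν
      refine eq_zero_of_multiplet_eq_zero e hC he ?_
      have hc (w : ι → SmoothFn d) (μ : Fin d) :
          fAnn (.cbar 1) (fCre (.cbar 1) (fCre (.ψ μ 0) (multiplet e w))) =
            fCre (.ψ μ 0) (multiplet e w) := by
        rw [fAnn_fCre_self, fAnn_fCre_of_ne _ (by simp), fAnn_multiplet, map_zero, neg_zero,
          map_zero, sub_zero]
      have h' := congrArg (fun w => fAnn (.ψ ν 0) (fAnn (.cbar 1) w)) h0
      simp only [map_sub, map_sum, hc, fAnn_bCre, fAnn_multiplet, map_zero, sub_zero] at h'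
      rw [← map_sum] at h'
      -- What is left after contracting `c̄_(-2)` is `matterV e y`, with `y` in place of the
      -- perturbation.
      exact (fAnn_psi_matterV e ν y).symm.trans h'
  · rintro ⟨hu, hy⟩
    rw [show u = 0 from funext hu, show y = 0 from funext fun ν => funext (hy ν)]
    simp

end Injectivity

end Ambitwistor

end

theorem mainTheorem3 {𝔤 ι : Type*} [LieRing 𝔤] [LieAlgebra ℝ 𝔤] [LieAlgebra.IsSimple ℝ 𝔤]
    [Fintype ι] [DecidableEq ι] (e : Module.Basis ι ℝ 𝔤) (C : ℝ) (hC : 0 < C)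
    (he : ∀ a b, killingForm ℝ 𝔤 (e a) (e b) = if a = b then -C else 0)
    (d : ℕ) (A a : Fin d → ι → Ambitwistor.SmoothFn d) :
    Ambitwistor.brstQ e C A (Ambitwistor.gluonV e a) =
        ∑ i, Ambitwistor.fC (-1) (Ambitwistor.fCbar (-1)
          ((∑ ν, Ambitwistor.fCbar (-2) (Ambitwistor.fPsi ν (-1) (Ambitwistor.fJ (e i) (-1)
              (Ambitwistor.fnState 𝔤 (Ambitwistor.linYM e A a ν i)))))
            - Ambitwistor.fGamma (-2) (Ambitwistor.fJ (e i) (-1)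
              (Ambitwistor.fnState 𝔤 (Ambitwistor.lorenz e A a i))))) ∧
      (Ambitwistor.brstQ e C A (Ambitwistor.gluonV e a) = 0 ↔
        (∀ i, Ambitwistor.lorenz e A a i = 0) ∧
          ∀ ν i, Ambitwistor.linYM e A a ν i = 0) := by
  rw [Ambitwistor.brst_image_eq, Ambitwistor.brstQ_gluonV e hC.ne' he]
  exact ⟨rfl, Ambitwistor.ccbar_eq_zero_iff e hC.ne' he _ _⟩
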